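/- Let $N\ge 8$ be even, $L$ odd, $r=\lceil N/L\rceil\ge 5$ and $w=e^{2\pi \mathbf{i}L/N}$. Signals $\mathbf z\in\mathbb C^N$ are extended $N$-periodically; $\hat z_k=\sum_{n=0}^{N-1}z_ne^{-2\pi \mathbf{i}kn/N}$ is the DFT. A signal is *analytic* if it is $A\mathbf x$ for some $\mathbf x\in\mathbb R^N$, where $\widehat{A\mathbf x}_k$ is $\hat x_k$ for $k\in\{0,N/2\}$, $2\hat x_k$ for $1\le k\le N/2-1$, and $0$ for $N/2<k\le N-1$. A property holds for *generic* analytic signals if there is a nonzero real polynomial $P$ in $N$ variables such that it holds for $A\mathbf x$ whenever $P(\mathbf x)\ne0$. The $[N,L]$-FROG measurements of $\mathbf z$ are $$|\hat y_{k,m}|^2=\Big|\sum_{n=0}^{N-1}z_nz_{n+mL}e^{-2\pi \mathbf{i}kn/N}\Big|^2,\qquad 0\le k\le N-1,\ 0\le m\le r-1 .$$ The *ambiguity* consists of the compositions of $\mathbf z\mapsto-\mathbf z$, integer translations $z_n\mapsto z_{n+l}$ ($l\in\mathbb Z$), and the reflection $z_n\mapsto\overline{z_{-n}}$. *Prescribed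 measurements.* Call a choice of shifts in $\{0,\dots,r-1\}$ admissible if it consists of - five distinct $i_2^{(1)}=0,i_2^{(2)},\dots,i_2^{(5)}$ with $w^{2i_2^{(q)}}\ne-1$ for all $q$ and $\frac{w^{i_2^{(2)}}}{1+w^{2i_2^{(2)}}}\ne\frac12$; - $i_3\ge1$ with $w^{3i_3}\ne-1$ and $\frac{w^{i_3}+w^{2i_3}}{1+w^{3i_3}}\ne1$; - for each $4\le k\le N/2$, three distinct $i_k^{(1)}=0,i_k^{(2)},i_k^{(3)}$ with $w^{ki_k^{(p)}}\ne-1$ for all $p$ and $i_k^{(2)}+i_k^{(3)}\ne r$. The prescribed measurements are $|\hat y_{k,m}|^2$ for $(k,m)$ equal to $(0,0),(0,1),(1,0)$, $(2,i_2^{(q)})$ ($1\le q\le5$), $(3,0),(3,i_3)$, and $(k,i_k^{(p)})$ ($4\le k\le N/2$, $1\le p\le3$). *Algorithm* (it uses only the prescribed measurements). 1. If $|\hat y_{0,1}|=0$, put $u_0=\sqrt{N|\hat y_{0,0}|/2}$. Otherwise put $t_0=\sqrt{N(|\hat y_{0,0}|+|\hat y_{0,1}|)/2}$ and $t_1=\frac{N|\hat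 y_{1,0}|}{2t_0}$; if some $c\in\mathbb C$ satisfies $\frac1N|t_0c(1+w^{2i_2^{(q)}})+t_1^2w^{i_2^{(q)}}|=|\hat y_{2,i_2^{(q)}}|$ for $q=1,\dots,5$, put $u_0=t_0$, and if not, put $u_0=\sqrt{N(|\hat y_{0,0}|-|\hat y_{0,1}|)/2}$. 2. Put $u_1=\frac{N|\hat y_{1,0}|}{2|u_0|}$. Let $E_{k,m}$ denote the equation $|\hat y_{k,m}|=\frac1N\big|\sum_{l=0}^ku_lu_{k-l}w^{lm}\big|$. Choose a solution $u_2$ of $E_{2,0},E_{2,i_2^{(2)}}$; then a solution $(u_3,u_4)$ of $E_{3,0},E_{3,i_3},E_{4,i_4^{(p)}}$ ($p=1,2,3$); then, successively for $j=5,\dots,N/2$, a solution $u_j$ of $E_{j,i_j^{(p)}}$ ($p=1,2,3$). 3. The output is the signal $\mathring{\mathbf z}$ with $\hat{\mathring z}_k=u_ke^{-\mathbf{i}\frac{2k}N\arg(u_{N/2})}$ for $0\le k\le N/2$ and $\hat{\mathring z}_k=0$ for $N/2<k\le N-1$. **Theorem.** For every admissible choice of shifts the prescribed measurements are $3N/2+1$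 in number. Moreover, generic analytic signals $\mathbf z\in\mathbb C^N$ with $\hat z_0\ne0$ and $\hat z_1\ne0$ have, for every admissible choice of shifts (the polynomial $P$ depending only on $N$ and $L$), the following properties. Run on the prescribed measurements of $\mathbf z$, the algorithm can choose $u_2$, and after any choice of $u_2$ all further steps can be carried out in exactly one way. Every output $\mathring{\mathbf z}$ equals $\mathbf z$ up to the ambiguity, and the analytic signals with the same $[N,L]$-FROG measurements as $\mathbf z$ (for all $0\le k\le N-1$, $0\le m\le r-1$) are exactly those that equal $\mathring{\mathbf z}$ up to the ambiguity. In particular, every analytic signal with the same $3N/2+1$ prescribed measurements as $\mathbf z$ equals $\mathbf z$ up to the ambiguity. -/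

import Mathlib

noncomputable section

namespace FROG

/-! Signals of length `N` are functions `ZMod N → ℂ` (so they are `N`-periodic), and the DFT is
`ZMod.dft z k = ∑ n, z n * exp (-2 π i k n / N)`. -/

/-- The number `r = ⌈N / L⌉` of shifts. -/
def numShifts (N L : ℕ) : ℕ := ⌈(N : ℝ) / (L : ℝ)⌉₊

/-- The `[N, L]`-FROG measurement `|ŷ_{k,m}|²` of `z`, the squared modulus of the DFT at `k` of the
product `y_{n,m} = z_n z_{n+mL}`. -/
def measurement {N : ℕ} [NeZero N] (L : ℕ) (z : ZMod N → ℂ) (k m : ℕ) : ℝ :=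
  ‖ZMod.dft (fun n : ZMod N => z n * z (n + ((m * L : ℕ) : ZMod N))) (k : ZMod N)‖ ^ 2

/-- The factor by which the DFT of a real signal is multiplied to get that of its analytic signal:
`1` at frequencies `0` and `N/2`, `2` strictly between them, `0` beyond `N/2`. -/
def analyticFactor {N : ℕ} (k : ZMod N) : ℂ :=
  if k.val = 0 then 1
  else if 2 * k.val < N then 2
  else if 2 * k.val = N then 1
  else 0

/-- The analytic signal `Ax` of a real signal `x`. -/
def analyticSignal {N : ℕ} [NeZero N] (x : ZMod N → ℝ) : ZMod N → ℂ :=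
  ZMod.dft.symm (fun k : ZMod N =>
    analyticFactor k * ZMod.dft (fun n : ZMod N => ((x n : ℝ) : ℂ)) k)

/-- `z` is analytic if it is the analytic signal of some real signal. -/
def IsAnalytic {N : ℕ} [NeZero N] (z : ZMod N → ℂ) : Prop :=
  ∃ x : ZMod N → ℝ, z = analyticSignal x

/-- A property holds for generic analytic signals if it holds for all `Ax` with `x ∈ ℝ^N` outside
the zero set of some nonzero real polynomial. Since `x ↦ Ax` is a real-linear bijection from `ℝ^N`
onto the analytic signals, this is genericity in the real vector space of analytic signals. -/
def ForGenericAnalytic (N : ℕ) [NeZero N] (Q : (ZMod N → ℂ) → Prop) : Prop :=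
  ∃ P : MvPolynomial (ZMod N) ℝ, P ≠ 0 ∧
    ∀ x : ZMod N → ℝ, MvPolynomial.eval x P ≠ 0 → Q (analyticSignal x)

/-- The translation by an integer `l`; its DFT is `k ↦ ẑ_k exp (2 π i k l / N)`. -/
def translate {N : ℕ} (l : ℤ) (z : ZMod N → ℂ) : ZMod N → ℂ :=
  fun n => z (n + (l : ZMod N))

/-- The reflection, with entries the complex conjugates of `z_{-n}`. -/
def reflect {N : ℕ} (z : ZMod N → ℂ) : ZMod N → ℂ :=
  fun n => (starRingEnd ℂ) (z (-n))

/-- `z'` arises from `z` by a composition of `π`-rotation (`z ↦ -z`), integer translation and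
reflection. -/
def SameUpToAmbiguity {N : ℕ} (z' z : ZMod N → ℂ) : Prop :=
  ∃ (s : ℂ) (l : ℤ), (s = 1 ∨ s = -1) ∧
    (z' = s • translate l z ∨ z' = s • translate l (reflect z))

/-- The root of unity `w = exp (2 π i L / N)`, for which
`ŷ_{k,m} = (1/N) ∑_l ẑ_l ẑ_{k-l} w^{lm}`; it is `exp (2 π i / r)` when `L` divides `N`. -/
def rootW (N L : ℕ) : ℂ :=
  Complex.exp (2 * (Real.pi : ℂ) * Complex.I * (L : ℂ) / (N : ℂ))

/-- A choice of shifts: `i2 q` is `i_2^{(q+1)}`, `i3` is `i_3`, and `ik k p` is `i_k^{(p+1)}`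
(used for `4 ≤ k ≤ N/2` only). -/
structure Shifts where
  i2 : Fin 5 → ℕ
  i3 : ℕ
  ik : ℕ → Fin 3 → ℕ

/-- The requirements on the shifts of the prescribed measurements. -/
structure Shifts.Admissible (N L : ℕ) (I : Shifts) : Prop where
  i2_lt : ∀ q, I.i2 q < numShifts N L
  i2_injective : Function.Injective I.i2
  i2_first : I.i2 0 = 0
  i2_ne : ∀ q, rootW N L ^ (2 * I.i2 q) ≠ -1
  i2_second : rootW N L ^ (I.i2 1) / (1 + rootW N L ^ (2 * I.i2 1)) ≠ 1 / 2
  i3_pos : 1 ≤ I.i3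
  i3_lt : I.i3 < numShifts N L
  i3_ne : rootW N L ^ (3 * I.i3) ≠ -1
  i3_ratio : (rootW N L ^ I.i3 + rootW N L ^ (2 * I.i3)) / (1 + rootW N L ^ (3 * I.i3)) ≠ 1
  ik_lt : ∀ k, 4 ≤ k → k ≤ N / 2 → ∀ p, I.ik k p < numShifts N L
  ik_injective : ∀ k, 4 ≤ k → k ≤ N / 2 → Function.Injective (I.ik k)
  ik_first : ∀ k, 4 ≤ k → k ≤ N / 2 → I.ik k 0 = 0
  ik_ne : ∀ k, 4 ≤ k → k ≤ N / 2 → ∀ p, rootW N L ^ (k * I.ik k p) ≠ -1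
  ik_sum : ∀ k, 4 ≤ k → k ≤ N / 2 → I.ik k 1 + I.ik k 2 ≠ numShifts N L

/-- The set of the pairs `(k, m)` at which the prescribed measurements are taken. -/
def Shifts.positions (N : ℕ) (I : Shifts) : Finset (ℕ × ℕ) :=
  {(0, 0), (0, 1), (1, 0)} ∪ Finset.univ.image (fun q : Fin 5 => (2, I.i2 q)) ∪
    {(3, 0), (3, I.i3)} ∪
    (Finset.Icc 4 (N / 2)).biUnion
      (fun k => Finset.univ.image (fun p : Fin 3 => (k, I.ik k p)))

/-! In the algorithm the data are `b k m = |ŷ_{k,m}|²`, of which only the entries at the prescribed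
positions are read; `√(b k m)` is `|ŷ_{k,m}|`. -/

/-- The output `ẑ₀` of the first part of the algorithm, which finds the modulus of `ẑ₀`. -/
def firstEntry (N L : ℕ) (I : Shifts) (b : ℕ → ℕ → ℝ) : ℝ :=
  open Classical in
  if √(b 0 1) = 0 then √(N * √(b 0 0) / 2)
  else
    let t₀ : ℝ := √(N * (√(b 0 0) + √(b 0 1)) / 2)
    let t₁ : ℝ := N * √(b 1 0) / (2 * t₀)
    if ∃ c : ℂ, ∀ q : Fin 5,
        1 / (N : ℝ) * ‖(t₀ : ℂ) * c * (1 + rootW N L ^ (2 * I.i2 q))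
          + (t₁ : ℂ) ^ 2 * rootW N L ^ (I.i2 q)‖ = √(b 2 (I.i2 q))
    then t₀
    else √(N * (√(b 0 0) - √(b 0 1)) / 2)

/-- The equation `|ŷ_{k,m}| = (1/N) |∑_{l=0}^{k} u_l u_{k-l} w^{lm}|` for the entries of `u`. -/
def Fits (N L : ℕ) (b : ℕ → ℕ → ℝ) (u : ℕ → ℂ) (k m : ℕ) : Prop :=
  √(b k m) =
    1 / (N : ℝ) * ‖∑ l ∈ Finset.range (k + 1), u l * u (k - l) * rootW N L ^ (l * m)‖

/-- `u = (u_0, ..., u_n, 0, 0, ...)` is a possible state of the second part of the algorithm at the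
moment when the entries up to index `n` have been computed. This part starts from `u_0` (the output
of the first part) and `u_1`; its first step chooses a solution `u_2` of two equations, its second
step takes a solution `(u_3, u_4)` of five equations, and its third step takes, successively for
`j = 5, 6, ...`, a solution `u_j` of three equations. So the meaningful values are
`n = 2, 4, 5, ..., N/2`. -/
structure IsState (N L : ℕ) (I : Shifts) (b : ℕ → ℕ → ℝ) (n : ℕ) (u : ℕ → ℂ) : Prop where
  entry_zero : u 0 = ((firstEntry N L I b : ℝ) : ℂ)
  entry_one : u 1 = ((N * √(b 1 0) / (2 * |firstEntry N L I b|) : ℝ) : ℂ)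
  step_one : Fits N L b u 2 0 ∧ Fits N L b u 2 (I.i2 1)
  step_two : 4 ≤ n → Fits N L b u 3 0 ∧ Fits N L b u 3 I.i3 ∧ ∀ p, Fits N L b u 4 (I.ik 4 p)
  step_three : ∀ j, 5 ≤ j → j ≤ n → ∀ p, Fits N L b u j (I.ik j p)
  tail : ∀ j, n < j → u j = 0

/-- The last part of the algorithm: from `u = (u_0, ..., u_{N/2}, 0, ...)` the signal with DFT
`k ↦ u_k exp (-i (2k/N) arg u_{N/2})`. -/
def finalSignal (N : ℕ) [NeZero N] (u : ℕ → ℂ) : ZMod N → ℂ :=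
  ZMod.dft.symm (fun k : ZMod N =>
    u k.val * Complex.exp
      (-(Complex.I * (2 * (k.val : ℂ) / (N : ℂ)) * ((Complex.arg (u (N / 2)) : ℝ) : ℂ))))

/-- `o` is an output of the whole algorithm on the data `b`. (The algorithm makes a choice between
solutions, hence a relation.) -/
def IsOutput (N L : ℕ) [NeZero N] (I : Shifts) (b : ℕ → ℕ → ℝ) (o : ZMod N → ℂ) : Prop :=
  ∃ u : ℕ → ℂ, IsState N L I b (N / 2) u ∧ o = finalSignal N u

end FROG

end

/-! For an analytic signal the FROG system is triangular: at a frequency `1 ≤ k ≤ N/2` only `ẑ_0,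
..., ẑ_k` enter (`measurement_eq`). Pairing `l` with `k - l` factors out `(1 + w^{km})/2` and leaves
`2 u_0 u_k` plus a cross term of earlier entries with real coefficients `cosRatio`
(`sum_eq_crossTerm`). Each measurement therefore prescribes the distance from `2 u_0 u_k` to a known
centre, and the question is how these centres lie.

A sign and a linear phase normalize `ẑ_0` and `ẑ_1` to be positive. At `k = 2` the centres are real,
so two distances leave `u_2` or its conjugate; this is the reflection ambiguity. At `k = 3` they lie
on the line of `u_1 u_2`, and two distances leave `u_3` or a mirror image. The three equations at `k
= 4` rule out the mirror image, since eliminating `u_4` gives a polynomial condition on the true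
spectrum (`excluder_eq_zero`). From `k = 4` on, three non-collinear centres determine `u_k`
(`IsState.eq_of_spread`). Hence every state is a truncation of the normal form or of its conjugate
(`IsState.eq_or_eq_conj`).

The modulus of `ẑ_0` has two candidates, coming from `ẑ_0² ± ẑ_{N/2}²`. The equations at frequency 2
determine `|ẑ_1|`, and a wrong larger candidate contradicts this (`firstEntry_eq`). At the end,
`ẑ_{N/2}` being real makes the leftover linear phase an `N`-th root of unity, that is, a translation
(`IsNormalForm.finalSignal`).

The exceptional set is cut out by finitely many polynomials, one or more for each admissible pair of
shifts; witnesses in `exists_spread_ne_zero` and `exists_spectrumExcluder_ne_zero` show that they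
are nonzero. -/

namespace FROG

open ZMod

/-! ### The ambiguity is an equivalence relation -/

section Ambiguity

variable {N : ℕ}

lemma translate_smul (l : ℤ) (s : ℂ) (z : ZMod N → ℂ) :
    translate l (s • z) = s • translate l z := rfl

lemma translate_translate (l m : ℤ) (z : ZMod N → ℂ) :
    translate l (translate m z) = translate (l + m) z := by
  ext n; simp [translate, add_assoc]

lemma reflect_translate (l : ℤ) (z : ZMod N → ℂ) :
    reflect (translate l z) = translate (-l) (reflect z) := by
  ext n; simp only [reflect, translate]; congr 2; push_cast; ring

lemma reflect_reflect (z : ZMod N → ℂ) : reflect (reflect z) = z := by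
  ext n; simp [reflect]

lemma reflect_smul {s : ℂ} (hs : s = 1 ∨ s = -1) (z : ZMod N → ℂ) :
    reflect (s • z) = s • reflect z := by
  ext n; rcases hs with rfl | rfl <;> simp [reflect]

lemma translate_zero (z : ZMod N → ℂ) : translate 0 z = z := by
  ext n; simp [translate]

lemma sign_mul {s t : ℂ} (hs : s = 1 ∨ s = -1) (ht : t = 1 ∨ t = -1) :
    s * t = 1 ∨ s * t = -1 := by
  rcases hs with rfl | rfl <;> rcases ht with rfl | rfl <;> simp

lemma SameUpToAmbiguity.reflect_self (z : ZMod N → ℂ) : SameUpToAmbiguity (reflect z) z :=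
  ⟨1, 0, Or.inl rfl, Or.inr (by rw [translate_zero, one_smul])⟩

lemma SameUpToAmbiguity.trans {x y z : ZMod N → ℂ} (h : SameUpToAmbiguity x y)
    (h' : SameUpToAmbiguity y z) : SameUpToAmbiguity x z := by
  obtain ⟨s, l, hs, h⟩ := h
  obtain ⟨t, m, ht, h'⟩ := h'
  rcases h with rfl | rfl <;> rcases h' with rfl | rfl
  · exact ⟨s * t, l + m, sign_mul hs ht, Or.inl (by
      rw [translate_smul, translate_translate, smul_smul])⟩
  · exact ⟨s * t, l + m, sign_mul hs ht, Or.inr (by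
      rw [translate_smul, translate_translate, smul_smul])⟩
  · exact ⟨s * t, l + -m, sign_mul hs ht, Or.inr (by
      rw [reflect_smul ht, reflect_translate, translate_smul, translate_translate, smul_smul])⟩
  · exact ⟨s * t, l + -m, sign_mul hs ht, Or.inl (by
      rw [reflect_smul ht, reflect_translate, translate_smul, translate_translate, smul_smul,
        reflect_reflect])⟩

lemma SameUpToAmbiguity.symm {x y : ZMod N → ℂ} (h : SameUpToAmbiguity x y) :
    SameUpToAmbiguity y x := by
  obtain ⟨s, l, hs, h⟩ := h
  have hss : s * s = 1 := by rcases hs with rfl | rfl <;> norm_num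
  rcases h with rfl | rfl
  · exact ⟨s, -l, hs, Or.inl (by
      rw [translate_smul, translate_translate, smul_smul, hss, neg_add_cancel, translate_zero,
        one_smul])⟩
  · exact ⟨s, l, hs, Or.inr (by
      rw [reflect_smul hs, reflect_translate, translate_smul, translate_translate, smul_smul, hss,
        add_neg_cancel, translate_zero, one_smul, reflect_reflect])⟩

end Ambiguity

/-! ### Fourier identities and invariance of the measurements -/

section Fourier

variable {N : ℕ} [NeZero N]

lemma rootW_pow_eq_stdAddChar (L n : ℕ) :
    rootW N L ^ n = stdAddChar ((n * L : ℕ) : ZMod N) := by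
  have h := stdAddChar_coe (N := N) ((n * L : ℕ) : ℤ)
  rw [Int.cast_natCast] at h
  rw [h, rootW, ← Complex.exp_nat_mul]
  congr 1
  push_cast
  ring

lemma norm_stdAddChar (j : ZMod N) : ‖(stdAddChar j : ℂ)‖ = 1 := by
  rw [stdAddChar_apply]; exact Circle.norm_coe _

lemma conj_stdAddChar (j : ZMod N) :
    (starRingEnd ℂ) (stdAddChar j : ℂ) = stdAddChar (-j) := by
  rw [AddChar.map_neg_eq_inv, Complex.inv_def, Complex.normSq_eq_norm_sq, norm_stdAddChar]
  simp

lemma dft_comp_add (z : ZMod N → ℂ) (t k : ZMod N) :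
    dft (fun n => z (n + t)) k = stdAddChar (t * k) * dft z k := by
  rw [dft_apply, dft_apply, Finset.mul_sum]
  refine Fintype.sum_equiv (Equiv.addRight t) _ _ fun n => ?_
  simp only [Equiv.coe_addRight, smul_eq_mul]
  rw [← mul_assoc, ← AddChar.map_add_eq_mul]
  congr 2
  ring

lemma dft_translate (l : ℤ) (z : ZMod N → ℂ) (k : ZMod N) :
    dft (translate l z) k = stdAddChar ((l : ZMod N) * k) * dft z k :=
  dft_comp_add z _ k

lemma dft_conj (z : ZMod N → ℂ) (k : ZMod N) :
    dft (fun n => (starRingEnd ℂ) (z n)) k = (starRingEnd ℂ) (dft z (-k)) := by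
  simp only [dft_apply, smul_eq_mul, map_sum, map_mul, conj_stdAddChar, mul_neg, neg_neg]

lemma dft_reflect (z : ZMod N → ℂ) (k : ZMod N) :
    dft (reflect z) k = (starRingEnd ℂ) (dft z k) := by
  have h := dft_conj (fun j => z (-j)) k
  rw [dft_comp_neg] at h
  simp only [neg_neg] at h
  exact h

/-- Fourier inversion of the shifted factor and an exchange of sums give a convolution weighted by
the character of the shift. -/
lemma dft_mul_shift (z : ZMod N → ℂ) (t k : ZMod N) :
    dft (fun n => z n * z (n + t)) k =
      (N : ℂ)⁻¹ * ∑ l : ZMod N, dft z l * dft z (k - l) * stdAddChar (l * t) := by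
  have hz : ∀ n, z (n + t) = (N : ℂ)⁻¹ * ∑ l, stdAddChar (l * (n + t)) * dft z l := by
    intro n
    have := invDFT_apply (dft z) (n + t)
    rwa [LinearEquiv.symm_apply_apply] at this
  rw [dft_apply]
  simp only [hz, smul_eq_mul, Finset.mul_sum]
  rw [Finset.sum_comm]
  refine Finset.sum_congr rfl fun l _ => ?_
  rw [dft_apply z (k - l)]
  simp only [smul_eq_mul, Finset.mul_sum, Finset.sum_mul]
  refine Finset.sum_congr rfl fun n _ => ?_
  have h : (stdAddChar (-(n * (k - l))) : ℂ) = stdAddChar (-(n * k)) * stdAddChar (l * n) := by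
    rw [← AddChar.map_add_eq_mul]; congr 1; ring
  rw [h, mul_add, AddChar.map_add_eq_mul]
  ring

lemma measurement_translate (L : ℕ) (l : ℤ) (z : ZMod N → ℂ) (k m : ℕ) :
    measurement L (translate l z) k m = measurement L z k m := by
  have h := dft_comp_add (fun n : ZMod N => z n * z (n + ((m * L : ℕ) : ZMod N))) (l : ZMod N) k
  have h2 : (fun n : ZMod N => translate l z n * translate l z (n + ((m * L : ℕ) : ZMod N))) =
      fun n => z (n + (l : ZMod N)) * z (n + (l : ZMod N) + ((m * L : ℕ) : ZMod N)) := by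
    ext n; simp only [translate]; rw [add_right_comm]
  rw [measurement, h2, h, norm_mul, norm_stdAddChar, one_mul, measurement]

lemma measurement_reflect (L : ℕ) (z : ZMod N → ℂ) (k m : ℕ) :
    measurement L (reflect z) k m = measurement L z k m := by
  set t : ZMod N := ((m * L : ℕ) : ZMod N) with ht
  -- Reflection swaps the roles of the two factors; the resulting translation by `t` only multiplies
  -- the DFT by a unimodular number.
  have h2 : (fun n : ZMod N => reflect z n * reflect z (n + t)) =
      fun n => reflect (fun n => z n * z (n + t)) (n + t) := by
    ext n
    simp only [reflect, map_mul]
    rw [mul_comm, show -(n + t) + t = -n by ring]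
  rw [measurement, ← ht, h2, dft_comp_add, norm_mul, norm_stdAddChar, one_mul, dft_reflect,
    RCLike.norm_conj, measurement]

lemma measurement_smul (L : ℕ) {s : ℂ} (hs : s = 1 ∨ s = -1) (z : ZMod N → ℂ) (k m : ℕ) :
    measurement L (s • z) k m = measurement L z k m := by
  rcases hs with rfl | rfl <;> simp [measurement]

lemma SameUpToAmbiguity.measurement_eq {x y : ZMod N → ℂ} (h : SameUpToAmbiguity x y)
    (L k m : ℕ) : measurement L x k m = measurement L y k m := by
  obtain ⟨s, l, hs, rfl | rfl⟩ := h <;>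
  simp only [measurement_smul L hs, measurement_translate, measurement_reflect]

end Fourier

/-! ### Analytic signals characterized by their spectra -/

section Analytic

variable {N : ℕ} [NeZero N]

/-- The spectrum of an analytic signal. -/
structure AnalyticSpectrum (N : ℕ) (a : ZMod N → ℂ) : Prop where
  conj_zero : (starRingEnd ℂ) (a 0) = a 0
  conj_half : ∀ k : ZMod N, 2 * k.val = N → (starRingEnd ℂ) (a k) = a k
  tail : ∀ k : ZMod N, N < 2 * k.val → a k = 0

lemma neg_eq_self_of_two_mul_val {k : ZMod N} (hk : 2 * k.val = N) : -k = k := by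
  rw [neg_eq_iff_add_eq_zero]
  have : ((k.val + k.val : ℕ) : ZMod N) = 0 := by
    rw [← two_mul, hk]; exact ZMod.natCast_self N
  simpa using this

lemma analyticSpectrum_dft_analyticSignal (x : ZMod N → ℝ) :
    AnalyticSpectrum N (dft (analyticSignal x)) := by
  have hx : ∀ k, (starRingEnd ℂ) (dft (fun n : ZMod N => ((x n : ℝ) : ℂ)) k) =
      dft (fun n : ZMod N => ((x n : ℝ) : ℂ)) (-k) := by
    intro k
    have := dft_conj (fun n : ZMod N => ((x n : ℝ) : ℂ)) (-k)
    simp only [Complex.conj_ofReal, neg_neg] at this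
    exact this.symm
  unfold analyticSignal
  rw [LinearEquiv.apply_symm_apply]
  refine ⟨?_, ?_, ?_⟩
  · rw [map_mul, hx, neg_zero]; simp [analyticFactor]
  · intro k hk
    have h0 : k.val ≠ 0 := by have := NeZero.ne N; omega
    rw [map_mul, hx, neg_eq_self_of_two_mul_val hk]; simp [analyticFactor, h0, hk]
  · intro k hk
    have h0 : k.val ≠ 0 := by omega
    have h1 : ¬ 2 * k.val < N := by omega
    have h2 : ¬ 2 * k.val = N := by omega
    simp [analyticFactor, h0, h1, h2]

/-- An analytic signal is the analytic signal of its real part. -/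
lemma dft_analyticSignal_re {z : ZMod N → ℂ} (h : AnalyticSpectrum N (dft z)) :
    analyticSignal (fun n => (z n).re) = z := by
  unfold analyticSignal
  rw [LinearEquiv.symm_apply_eq]
  have hre : (fun n : ZMod N => (((z n).re : ℝ) : ℂ)) =
      (2 : ℂ)⁻¹ • (z + fun n => (starRingEnd ℂ) (z n)) := by
    ext n
    simp only [Pi.smul_apply, Pi.add_apply, smul_eq_mul, Complex.add_conj]
    push_cast
    ring
  funext k
  rw [hre, _root_.map_smul, map_add, Pi.smul_apply, Pi.add_apply, dft_conj, smul_eq_mul]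
  have hk := ZMod.val_lt k
  unfold analyticFactor
  -- Strictly between `0` and `N/2` the mirror frequency `-k` lies in the vanishing half, so the
  -- factor `2` undoes the `1/2` of the real part. At `0` and `N/2` the mirror frequency is `k`
  -- itself and the coefficient is real.
  split_ifs with h0 h1 h2
  · have : k = 0 := (ZMod.val_eq_zero k).mp h0
    subst this
    rw [neg_zero, h.conj_zero]; ring
  · have hne : k ≠ 0 := fun e => h0 (by rw [e, ZMod.val_zero])
    have : NeZero k := ⟨hne⟩
    have hv := ZMod.val_neg_of_ne_zero k
    rw [h.tail (-k) (by omega), map_zero]; ring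
  · rw [neg_eq_self_of_two_mul_val h2, h.conj_half k h2]; ring
  · rw [h.tail k (by omega)]; ring

lemma isAnalytic_iff (z : ZMod N → ℂ) : IsAnalytic z ↔ AnalyticSpectrum N (dft z) := by
  constructor
  · rintro ⟨x, rfl⟩
    exact analyticSpectrum_dft_analyticSignal x
  · intro h
    exact ⟨_, (dft_analyticSignal_re h).symm⟩

lemma stdAddChar_mul_real {k : ZMod N} (hk : 2 * k.val = N) (l : ZMod N) :
    (starRingEnd ℂ) (stdAddChar (l * k) : ℂ) = stdAddChar (l * k) := by
  rw [conj_stdAddChar, ← mul_neg, neg_eq_self_of_two_mul_val hk]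

lemma IsAnalytic.translate {z : ZMod N → ℂ} (h : IsAnalytic z) (l : ℤ) :
    IsAnalytic (translate l z) := by
  rw [isAnalytic_iff] at *
  refine ⟨?_, fun k hk => ?_, fun k hk => ?_⟩
  · rw [dft_translate]; simp [h.conj_zero]
  · rw [dft_translate, map_mul, stdAddChar_mul_real hk, h.conj_half k hk]
  · rw [dft_translate, h.tail k hk, mul_zero]

lemma IsAnalytic.reflect {z : ZMod N → ℂ} (h : IsAnalytic z) : IsAnalytic (reflect z) := by
  rw [isAnalytic_iff] at *
  refine ⟨?_, fun k hk => ?_, fun k hk => ?_⟩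
  · rw [dft_reflect, h.conj_zero, h.conj_zero]
  · rw [dft_reflect, h.conj_half k hk, h.conj_half k hk]
  · rw [dft_reflect, h.tail k hk, map_zero]

lemma IsAnalytic.smul {z : ZMod N → ℂ} (h : IsAnalytic z) {s : ℂ} (hs : s = 1 ∨ s = -1) :
    IsAnalytic (s • z) := by
  have hc : (starRingEnd ℂ) s = s := by rcases hs with rfl | rfl <;> simp
  rw [isAnalytic_iff] at *
  rw [_root_.map_smul]
  refine ⟨?_, fun k hk => ?_, fun k hk => ?_⟩
  · simp only [Pi.smul_apply, smul_eq_mul, map_mul, hc, h.conj_zero]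
  · simp only [Pi.smul_apply, smul_eq_mul, map_mul, hc, h.conj_half k hk]
  · simp only [Pi.smul_apply, smul_eq_mul, h.tail k hk, mul_zero]

lemma SameUpToAmbiguity.isAnalytic {x y : ZMod N → ℂ} (h : SameUpToAmbiguity x y)
    (hy : IsAnalytic y) : IsAnalytic x := by
  obtain ⟨s, l, hs, rfl | rfl⟩ := h
  · exact (hy.translate l).smul hs
  · exact (hy.reflect.translate l).smul hs

end Analytic

/-! ### Measurements of analytic signals in terms of the half spectrum -/

section Measurement

variable {N : ℕ} [NeZero N]

/-- The DFT coefficients of a signal, indexed by natural numbers. -/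
noncomputable def coeff (z : ZMod N → ℂ) (k : ℕ) : ℂ := dft z (k : ZMod N)

lemma coeff_eq_zero {z : ZMod N → ℂ} (hz : IsAnalytic z) {k : ℕ} (hk : N < 2 * k) (hkN : k < N) :
    coeff z k = 0 :=
  ((isAnalytic_iff z).mp hz).tail _ (by rwa [ZMod.val_cast_of_lt hkN])

lemma conj_coeff_zero {z : ZMod N → ℂ} (hz : IsAnalytic z) :
    (starRingEnd ℂ) (coeff z 0) = coeff z 0 := by
  have := ((isAnalytic_iff z).mp hz).conj_zero
  simpa [coeff] using this

lemma conj_coeff_half {z : ZMod N → ℂ} (hz : IsAnalytic z) {M : ℕ} (hM : N = 2 * M) :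
    (starRingEnd ℂ) (coeff z M) = coeff z M := by
  have hN := NeZero.ne N
  exact ((isAnalytic_iff z).mp hz).conj_half _ (by rw [ZMod.val_cast_of_lt (by omega)]; omega)

lemma measurement_eq_sum (L : ℕ) (z : ZMod N → ℂ) (k m : ℕ) :
    measurement L z k m = (1 / (N : ℝ) * ‖∑ l ∈ Finset.range N,
      coeff z l * dft z ((k : ZMod N) - (l : ZMod N)) * rootW N L ^ (l * m)‖) ^ 2 := by
  have hsum : ∀ f : ZMod N → ℂ, ∑ l : ZMod N, f l = ∑ l ∈ Finset.range N, f (l : ZMod N) := by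
    intro f
    refine Finset.sum_bij (fun l _ => l.val) (fun l _ => Finset.mem_range.mpr (ZMod.val_lt l))
      (fun l _ l' _ h => ZMod.val_injective N h) (fun n hn => ⟨(n : ZMod N), Finset.mem_univ _,
        ZMod.val_cast_of_lt (Finset.mem_range.mp hn)⟩) (fun l _ => by rw [ZMod.natCast_zmod_val])
  rw [measurement, dft_mul_shift, norm_mul, hsum, norm_inv, Complex.norm_natCast, one_div]
  congr 3
  refine Finset.sum_congr rfl fun l _ => ?_
  rw [rootW_pow_eq_stdAddChar, coeff]
  congr 2
  push_cast
  ring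

lemma dft_sub_eq_coeff (z : ZMod N → ℂ) {k l : ℕ} (h : l ≤ k) :
    dft z ((k : ZMod N) - (l : ZMod N)) = coeff z (k - l) := by
  rw [coeff, Nat.cast_sub h]

lemma dft_sub_eq_coeff_add (z : ZMod N → ℂ) {k l : ℕ} (h : l ≤ N + k) :
    dft z ((k : ZMod N) - (l : ZMod N)) = coeff z (N + k - l) := by
  rw [coeff, Nat.cast_sub h, Nat.cast_add, ZMod.natCast_self, zero_add]

/-- For `l > k`, one of the indices `l` and `N + k - l` exceeds `N/2`. Here `k ≥ 1` matters: for `k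
= 0` the term `l = N/2` survives. -/
lemma measurement_eq {z : ZMod N → ℂ} (hz : IsAnalytic z) {M : ℕ} (hM : N = 2 * M) (L : ℕ)
    {k : ℕ} (hk : 1 ≤ k) (hkM : k ≤ M) (m : ℕ) :
    measurement L z k m = (1 / (N : ℝ) * ‖∑ l ∈ Finset.range (k + 1),
      coeff z l * coeff z (k - l) * rootW N L ^ (l * m)‖) ^ 2 := by
  rw [measurement_eq_sum]
  congr 3
  have hsub : Finset.range (k + 1) ⊆ Finset.range N :=
    Finset.range_subset_range.mpr (by omega)
  rw [← Finset.sum_subset hsub]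
  · exact Finset.sum_congr rfl fun l hl => by
      rw [dft_sub_eq_coeff z (by rw [Finset.mem_range] at hl; omega)]
  · intro l hl hl'
    rw [Finset.mem_range] at hl hl'
    rcases le_or_gt l M with h | h
    · rw [dft_sub_eq_coeff_add z (by omega), coeff_eq_zero hz (k := N + k - l) (by omega)
        (by omega)]
      simp
    · rw [coeff_eq_zero hz (k := l) (by omega) hl]
      simp

lemma rootW_pow_half {M L : ℕ} (hM : N = 2 * M) (hL : Odd L) : rootW N L ^ M = -1 := by
  have hN0 : (N : ℂ) ≠ 0 := NeZero.ne _
  have hN : (N : ℂ) = 2 * M := by rw [hM]; push_cast; ring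
  have hM0 : (M : ℂ) ≠ 0 := fun h => hN0 (by rw [hN, h, mul_zero])
  have h : rootW N L ^ M = Complex.exp ((Real.pi : ℂ) * Complex.I) ^ L := by
    rw [rootW, ← Complex.exp_nat_mul, ← Complex.exp_nat_mul, hN]
    congr 1
    field_simp
  rw [h, Complex.exp_pi_mul_I, hL.neg_one_pow]

/-- Only `l = 0` and `l = N/2` can have both `ẑ_l` and `ẑ_{-l}` nonzero, and `w^{N/2} = -1` because
`L` is odd. -/
lemma measurement_zero_eq {z : ZMod N → ℂ} (hz : IsAnalytic z) {M : ℕ} (hM : N = 2 * M) {L : ℕ}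
    (hL : Odd L) (m : ℕ) :
    measurement L z 0 m =
      (1 / (N : ℝ) * ‖coeff z 0 ^ 2 + coeff z M ^ 2 * (-1) ^ m‖) ^ 2 := by
  rw [measurement_eq_sum]
  have hN := NeZero.ne N
  congr 3
  have hsub : ({0, M} : Finset ℕ) ⊆ Finset.range N := by
    intro l hl
    simp only [Finset.mem_insert, Finset.mem_singleton] at hl
    rw [Finset.mem_range]
    omega
  rw [← Finset.sum_subset hsub, Finset.sum_pair (by omega)]
  · rw [dft_sub_eq_coeff z le_rfl, dft_sub_eq_coeff_add z (by omega),
      pow_mul (rootW N L) M, rootW_pow_half hM hL, show N + 0 - M = M by omega]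
    simp only [Nat.sub_zero, zero_mul, pow_zero, mul_one, pow_two]
  · intro l hl hl'
    simp only [Finset.mem_insert, Finset.mem_singleton, not_or] at hl'
    rw [Finset.mem_range] at hl
    rcases le_or_gt l M with h | h
    · rw [dft_sub_eq_coeff_add z (by omega), coeff_eq_zero hz (k := N + 0 - l) (by omega)
        (by omega)]
      simp
    · rw [coeff_eq_zero hz (k := l) (by omega) hl]
      simp

/-- The spectrum of a signal fits its own measurements. -/
lemma fits_coeff {z : ZMod N → ℂ} (hz : IsAnalytic z) {M : ℕ} (hM : N = 2 * M) {L : ℕ}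
    {b : ℕ → ℕ → ℝ} {k m : ℕ} (hk : 1 ≤ k) (hkM : k ≤ M)
    (hb : b k m = measurement L z k m) : Fits N L b (coeff z) k m := by
  rw [Fits, hb, measurement_eq hz hM L hk hkM, Real.sqrt_sq (by positivity)]

end Measurement

/-! ### Coincidences among the powers of `w` -/

section RootsOfUnity

lemma rootW_pow_eq_one_iff {N : ℕ} [NeZero N] (L n : ℕ) : rootW N L ^ n = 1 ↔ N ∣ n * L := by
  rw [rootW_pow_eq_stdAddChar, ← (stdAddChar (N := N)).map_zero_eq_one,
    injective_stdAddChar.eq_iff, ZMod.natCast_eq_zero_iff]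

lemma norm_rootW {N : ℕ} [NeZero N] (L : ℕ) : ‖rootW N L‖ = 1 := by
  have := rootW_pow_eq_stdAddChar (N := N) L 1
  rw [pow_one] at this
  rw [this, norm_stdAddChar]

lemma rootW_ne_zero {N : ℕ} [NeZero N] (L : ℕ) : rootW N L ≠ 0 := by
  rw [← norm_ne_zero_iff, norm_rootW]; exact one_ne_zero

lemma numShifts_bounds {N L : ℕ} (hL : 0 < L) (hr : 0 < numShifts N L) :
    (numShifts N L - 1) * L < N ∧ N ≤ numShifts N L * L := by
  have hL' : (0 : ℝ) < L := by exact_mod_cast hL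
  constructor
  · have h : ((numShifts N L - 1 : ℕ) : ℝ) < (N : ℝ) / L := by
      rw [← Nat.lt_ceil]
      change numShifts N L - 1 < numShifts N L
      omega
    rw [lt_div_iff₀ hL'] at h
    exact_mod_cast h
  · have h : (N : ℝ) / L ≤ (numShifts N L : ℝ) := Nat.le_ceil _
    rw [div_le_iff₀ hL'] at h
    exact_mod_cast h

lemma rootW_pow_injOn {N L : ℕ} [NeZero N] (hL : 0 < L) {i j : ℕ} (hi : i < numShifts N L)
    (hj : j < numShifts N L) (h : rootW N L ^ i = rootW N L ^ j) : i = j := by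
  have hr : 0 < numShifts N L := by omega
  have hb := (numShifts_bounds hL hr).1
  wlog hij : i ≤ j generalizing i j
  · exact (this hj hi h.symm (by omega)).symm
  have h1 : rootW N L ^ (j - i) = 1 := by
    have h0 : rootW N L ^ i ≠ 0 := pow_ne_zero _ (rootW_ne_zero L)
    have h2 : rootW N L ^ i * rootW N L ^ (j - i) = rootW N L ^ i * 1 := by
      rw [← pow_add, Nat.add_sub_cancel' hij, mul_one, h]
    exact mul_left_cancel₀ h0 h2
  rw [rootW_pow_eq_one_iff] at h1
  have h3 : (j - i) * L ≤ (numShifts N L - 1) * L := Nat.mul_le_mul_right _ (by omega)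
  have h4 := Nat.eq_zero_of_dvd_of_lt h1 (by omega)
  rcases Nat.mul_eq_zero.mp h4 with h5 | h5 <;> omega

/-- The multiple `(i + j) L` of `N` lies strictly between `0` and `2N`, so it equals `N`; then `N /
L` is the integer `i + j`. -/
lemma add_eq_numShifts_of_rootW_pow {N L : ℕ} [NeZero N] (hL : 0 < L) {i j : ℕ}
    (hi : i < numShifts N L) (hj : j < numShifts N L) (hij : i ≠ j)
    (h : rootW N L ^ (i + j) = 1) : i + j = numShifts N L := by
  have hr : 0 < numShifts N L := by omega
  obtain ⟨h1, h2⟩ := numShifts_bounds hL hr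
  rw [rootW_pow_eq_one_iff] at h
  obtain ⟨c, hc⟩ := h
  have hN := NeZero.pos N
  have h3 : (i + j) * L < 2 * N := by
    calc (i + j) * L ≤ (2 * (numShifts N L - 1)) * L := Nat.mul_le_mul_right _ (by omega)
      _ = 2 * ((numShifts N L - 1) * L) := by ring
      _ < 2 * N := by omega
  have h4 : 0 < (i + j) * L := Nat.mul_pos (by omega) hL
  have h5 : c = 1 := by
    rw [hc] at h3 h4
    have : c < 2 := by
      by_contra hcc
      have : N * 2 ≤ N * c := Nat.mul_le_mul_left _ (by omega)
      omega
    have : c ≠ 0 := by rintro rfl; simp at h4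
    omega
  subst h5
  rw [mul_one] at hc
  generalize numShifts N L = r at *
  rw [← hc] at h1 h2
  have h6 := Nat.le_of_mul_le_mul_right h2 hL
  have h7 := Nat.lt_of_mul_lt_mul_right h1
  omega

lemma eq_or_mul_eq_one_of_re_eq {a b : ℂ} (ha : ‖a‖ = 1) (hb : ‖b‖ = 1) (h : a.re = b.re) :
    a = b ∨ a * b = 1 := by
  have ha2 : a.re * a.re + a.im * a.im = 1 := by
    rw [← Complex.normSq_apply, Complex.normSq_eq_norm_sq, ha]; norm_num
  have hb2 : b.re * b.re + b.im * b.im = 1 := by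
    rw [← Complex.normSq_apply, Complex.normSq_eq_norm_sq, hb]; norm_num
  have h3 : (a.im - b.im) * (a.im + b.im) = 0 := by rw [h] at ha2; linarith
  rcases mul_eq_zero.mp h3 with h4 | h4
  · exact Or.inl (Complex.ext h (by linarith))
  · refine Or.inr (Complex.ext ?_ ?_)
    · rw [Complex.mul_re, Complex.one_re, h, show a.im = -b.im by linarith]; linarith
    · rw [Complex.mul_im, Complex.one_im, h, show a.im = -b.im by linarith]; ring

lemma norm_rootW_pow {N : ℕ} [NeZero N] (L i : ℕ) : ‖rootW N L ^ i‖ = 1 := by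
  rw [norm_pow, norm_rootW, one_pow]

/-- Points of the unit circle with equal real parts are equal or mutually inverse; the condition `i
+ j ≠ r` excludes the latter. -/
lemma rootW_pow_re_ne {N L : ℕ} [NeZero N] (hL : 0 < L) {i j : ℕ} (hi : i < numShifts N L)
    (hj : j < numShifts N L) (hij : i ≠ j) (hsum : i + j ≠ numShifts N L) :
    (rootW N L ^ i).re ≠ (rootW N L ^ j).re := by
  intro h
  rcases eq_or_mul_eq_one_of_re_eq (norm_rootW_pow L i) (norm_rootW_pow L j) h with h | h
  · exact hij (rootW_pow_injOn hL hi hj h)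
  · rw [← pow_add] at h
    exact hsum (add_eq_numShifts_of_rootW_pow hL hi hj hij h)

end RootsOfUnity

/-! ### The real coefficients of the symmetrized system -/

section CosRatio

/-- For `o = exp (i θ)` this is `cos ((k/2 - l) θ) / cos (k θ / 2)`. -/
noncomputable def cosRatio (k l : ℕ) (o : ℂ) : ℝ := ((o ^ l + o ^ (k - l)) / (1 + o ^ k)).re

/-- Conjugation inverts `o`, and multiplying numerator and denominator by `o ^ k` returns the same
quotient. -/
lemma ofReal_cosRatio {k l : ℕ} {o : ℂ} (ho : ‖o‖ = 1) (hl : l ≤ k) :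
    (cosRatio k l o : ℂ) = (o ^ l + o ^ (k - l)) / (1 + o ^ k) := by
  have h0 : o ≠ 0 := by rw [← norm_ne_zero_iff, ho]; exact one_ne_zero
  have hc : (starRingEnd ℂ) o = o⁻¹ := by
    rw [Complex.inv_def, Complex.normSq_eq_norm_sq, ho]; simp
  have hk : o ^ k = o ^ l * o ^ (k - l) := by rw [← pow_add, Nat.add_sub_cancel' hl]
  rw [cosRatio, ← Complex.conj_eq_iff_re]
  simp only [map_div₀, map_add, hk, map_mul, map_pow, hc, map_one, inv_pow]
  have h1 : o ^ l ≠ 0 := pow_ne_zero _ h0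
  have h2 : o ^ (k - l) ≠ 0 := pow_ne_zero _ h0
  generalize o ^ l = A at *
  generalize o ^ (k - l) = B at *
  rw [← mul_inv]
  have h3 : A⁻¹ + B⁻¹ = (A + B) / (A * B) := by field_simp; ring
  have h4 : 1 + (A * B)⁻¹ = (1 + A * B) / (A * B) := by field_simp; ring
  rw [h3, h4, div_div_div_cancel_right₀ (mul_ne_zero h1 h2)]

variable {k l : ℕ} {o : ℂ}

lemma one_add_ne_zero_of_ne_neg_one {x : ℂ} (h : x ≠ -1) : 1 + x ≠ 0 :=
  fun e => h (eq_neg_of_add_eq_zero_right e)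

lemma cosRatio_mul (ho : ‖o‖ = 1) (hk : o ^ k ≠ -1) (hl : l ≤ k) :
    (cosRatio k l o : ℂ) * (1 + o ^ k) = o ^ l + o ^ (k - l) := by
  rw [ofReal_cosRatio ho hl, div_mul_cancel₀ _ (one_add_ne_zero_of_ne_neg_one hk)]

lemma cosRatio_zero (ho : ‖o‖ = 1) (hk : o ^ k ≠ -1) : cosRatio k 0 o = 1 := by
  have h := cosRatio_mul ho hk (Nat.zero_le k)
  rw [pow_zero, Nat.sub_zero] at h
  have := mul_right_cancel₀ (one_add_ne_zero_of_ne_neg_one hk) (h.trans (one_mul _).symm)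
  exact_mod_cast this

lemma cosRatio_symm (hl : l ≤ k) : cosRatio k (k - l) o = cosRatio k l o := by
  rw [cosRatio, cosRatio, Nat.sub_sub_self hl, add_comm (o ^ (k - l))]

lemma add_inv_eq_two_re (ho : ‖o‖ = 1) : o + o⁻¹ = ((2 * o.re : ℝ) : ℂ) := by
  have hc : o⁻¹ = (starRingEnd ℂ) o := by
    rw [Complex.inv_def, Complex.normSq_eq_norm_sq, ho]; simp
  rw [hc, Complex.add_conj]

/-- This is the addition formula for the cosines in the numerators: multiplication by `2 cos θ`
moves `l` to its two neighbours. -/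
lemma cosRatio_recurrence (ho : ‖o‖ = 1) (hk : o ^ k ≠ -1) (hl : l + 2 ≤ k) :
    cosRatio k (l + 2) o + cosRatio k l o = 2 * o.re * cosRatio k (l + 1) o := by
  have h0 : o ≠ 0 := by rw [← norm_ne_zero_iff, ho]; exact one_ne_zero
  obtain ⟨j, rfl⟩ := Nat.exists_eq_add_of_le hl
  have h1 := cosRatio_mul ho hk (l := l) (by omega)
  have h2 := cosRatio_mul ho hk (l := l + 1) (by omega)
  have h3 := cosRatio_mul ho hk (l := l + 2) (by omega)
  rw [show l + 2 + j - l = j + 2 by omega] at h1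
  rw [show l + 2 + j - (l + 1) = j + 1 by omega] at h2
  rw [show l + 2 + j - (l + 2) = j by omega] at h3
  have h4 := add_inv_eq_two_re ho
  have h5 : o * o⁻¹ = 1 := mul_inv_cancel₀ h0
  have h6 : ((cosRatio (l + 2 + j) (l + 2) o + cosRatio (l + 2 + j) l o : ℝ) : ℂ) =
      ((2 * o.re * cosRatio (l + 2 + j) (l + 1) o : ℝ) : ℂ) := by
    rw [Complex.ofReal_mul, Complex.ofReal_add, ← h4]
    refine mul_right_cancel₀ (one_add_ne_zero_of_ne_neg_one hk) ?_
    linear_combination h1 + h3 - (o + o⁻¹) * h2 - (o ^ l + o ^ j) * h5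
  exact_mod_cast h6

/-- For even `k` the numerator is `2 o ^ (k / 2)`. For odd `k` it vanishes only at `o = -1`, where
`o ^ k = -1`. -/
lemma cosRatio_half_ne_zero (ho : ‖o‖ = 1) (hk : o ^ k ≠ -1) : cosRatio k (k / 2) o ≠ 0 := by
  have h0 : o ≠ 0 := by rw [← norm_ne_zero_iff, ho]; exact one_ne_zero
  intro h
  have h1 := cosRatio_mul ho hk (l := k / 2) (by omega)
  rw [h, Complex.ofReal_zero, zero_mul] at h1
  rcases Nat.even_or_odd' k with ⟨j, hj | hj⟩
  · rw [show k / 2 = j by omega, show k - j = j by omega, ← two_mul] at h1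
    exact mul_ne_zero two_ne_zero (pow_ne_zero _ h0) h1.symm
  · rw [show k / 2 = j by omega, show k - j = j + 1 by omega] at h1
    have h2 : o ^ j * (1 + o) = 0 := by rw [h1]; ring
    rcases mul_eq_zero.mp h2 with h3 | h3
    · exact pow_ne_zero _ h0 h3
    · have h4 : o = -1 := eq_neg_of_add_eq_zero_right h3
      exact hk (by rw [h4, hj, pow_succ, pow_mul]; norm_num)

lemma eq_zero_of_moments {x η : Fin 3 → ℝ} (hx : Function.Injective x)
    (h0 : ∑ p, η p = 0) (h1 : ∑ p, η p * x p = 0) (h2 : ∑ p, η p * x p ^ 2 = 0) : η = 0 := by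
  rw [Fin.sum_univ_three] at h0 h1 h2
  have h01 : x 0 - x 1 ≠ 0 := sub_ne_zero.mpr (hx.ne (by decide))
  have h02 : x 0 - x 2 ≠ 0 := sub_ne_zero.mpr (hx.ne (by decide))
  have h12 : x 1 - x 2 ≠ 0 := sub_ne_zero.mpr (hx.ne (by decide))
  have e0 : η 0 * ((x 0 - x 1) * (x 0 - x 2)) = 0 := by
    linear_combination h2 - (x 1 + x 2) * h1 + x 1 * x 2 * h0
  have e1 : η 1 * ((x 0 - x 1) * (x 1 - x 2)) = 0 := by
    linear_combination -h2 + (x 0 + x 2) * h1 - x 0 * x 2 * h0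
  have e2 : η 2 * ((x 0 - x 2) * (x 1 - x 2)) = 0 := by
    linear_combination h2 - (x 0 + x 1) * h1 + x 0 * x 1 * h0
  funext p
  fin_cases p
  · exact (mul_eq_zero.mp e0).resolve_right (mul_ne_zero h01 h02)
  · exact (mul_eq_zero.mp e1).resolve_right (mul_ne_zero h01 h12)
  · exact (mul_eq_zero.mp e2).resolve_right (mul_ne_zero h02 h12)

/-- The vectors of values of `cosRatio k l` at three points with distinct real parts span. -/
lemma cosRatio_span {k : ℕ} (hk : 4 ≤ k) {o : Fin 3 → ℂ} (ho : ∀ p, ‖o p‖ = 1)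
    (hok : ∀ p, o p ^ k ≠ -1) (hre : Function.Injective fun p => (o p).re) {ν : Fin 3 → ℝ}
    (h0 : ∑ p, ν p = 0) (h : ∀ l ∈ Finset.Ico 1 k, ∑ p, ν p * cosRatio k l (o p) = 0) : ν = 0 := by
  have hE : ∀ l ≤ k, ∑ p, ν p * cosRatio k l (o p) = 0 := by
    intro l hl
    rcases Nat.eq_zero_or_pos l with rfl | hl0
    · simpa only [cosRatio_zero (ho _) (hok _), mul_one] using h0
    rcases hl.lt_or_eq with hlk | rfl
    · exact h l (Finset.mem_Ico.mpr ⟨hl0, hlk⟩)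
    · have h1 : ∀ p, cosRatio l l (o p) = 1 := fun p => by
        rw [← cosRatio_symm le_rfl, Nat.sub_self, cosRatio_zero (ho _) (hok _)]
      simpa only [h1, mul_one] using h0
  have hE1 : ∀ l, 1 ≤ l → l + 1 ≤ k →
      ∑ p, ν p * cosRatio k l (o p) * (2 * (o p).re) = 0 := by
    intro l hl hlk
    obtain ⟨j, rfl⟩ := Nat.exists_eq_add_of_le' hl
    have e1 := hE (j + 2) (by omega)
    have e2 := hE j (by omega)
    rw [← add_zero (0 : ℝ)]
    nth_rw 1 [← e1]
    nth_rw 1 [← e2]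
    rw [← Finset.sum_add_distrib]
    refine Finset.sum_congr rfl fun p _ => ?_
    have := cosRatio_recurrence (ho p) (hok p) (l := j) (by omega)
    linear_combination (-ν p) * this
  -- Each factor `2 cos θ` costs one index on either side. The index `k / 2` has room for two of
  -- them exactly because `k ≥ 4`; this gives three moments of the weights `ν p * cosRatio k (k / 2)
  -- (o p)`.
  have hE2 : ∀ l, 2 ≤ l → l + 2 ≤ k →
      ∑ p, ν p * cosRatio k l (o p) * (2 * (o p).re) ^ 2 = 0 := by
    intro l hl hlk
    obtain ⟨j, rfl⟩ := Nat.exists_eq_add_of_le' hl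
    have e1 := hE1 (j + 3) (by omega) (by omega)
    have e2 := hE1 (j + 1) (by omega) (by omega)
    rw [← add_zero (0 : ℝ)]
    nth_rw 1 [← e1]
    nth_rw 1 [← e2]
    rw [← Finset.sum_add_distrib]
    refine Finset.sum_congr rfl fun p _ => ?_
    have := cosRatio_recurrence (ho p) (hok p) (l := j + 1) (by omega)
    rw [show j + 1 + 2 = j + 3 from rfl, show j + 1 + 1 = j + 2 from rfl] at this
    linear_combination (-ν p * (2 * (o p).re)) * this
  have hη := eq_zero_of_moments (x := fun p => 2 * (o p).re)
    (η := fun p => ν p * cosRatio k (k / 2) (o p))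
    (fun p q hpq => hre (mul_left_cancel₀ two_ne_zero hpq)) (hE (k / 2) (by omega))
    (hE1 (k / 2) (by omega) (by omega)) (hE2 (k / 2) (by omega) (by omega))
  funext p
  exact (mul_eq_zero.mp (congrFun hη p)).resolve_right (cosRatio_half_ne_zero (ho p) (hok p))

lemma quadratic_eq_zero {y : Fin 3 → ℝ} (hy : Function.Injective y) {A B C : ℝ}
    (h : ∀ p, A * y p ^ 2 + B * y p + C = 0) : A = 0 ∧ B = 0 ∧ C = 0 := by
  have h01 : y 0 - y 1 ≠ 0 := sub_ne_zero.mpr (hy.ne (by decide))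
  have h02 : y 0 - y 2 ≠ 0 := sub_ne_zero.mpr (hy.ne (by decide))
  have h12 : y 1 - y 2 ≠ 0 := sub_ne_zero.mpr (hy.ne (by decide))
  have e1 : A * (y 0 + y 1) + B = 0 := by
    have : (y 0 - y 1) * (A * (y 0 + y 1) + B) = 0 := by linear_combination h 0 - h 1
    exact (mul_eq_zero.mp this).resolve_left h01
  have e2 : A * (y 0 + y 2) + B = 0 := by
    have : (y 0 - y 2) * (A * (y 0 + y 2) + B) = 0 := by linear_combination h 0 - h 2
    exact (mul_eq_zero.mp this).resolve_left h02
  have hA : A = 0 := by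
    have : A * (y 1 - y 2) = 0 := by linear_combination e1 - e2
    exact (mul_eq_zero.mp this).resolve_right h12
  have hB : B = 0 := by linear_combination e1 - (y 0 + y 1) * hA
  exact ⟨hA, hB, by linear_combination h 0 - y 0 ^ 2 * hA - y 0 * hB⟩

/-- With `y = 2 cos θ` the two ratios are `y / (y² - 2)` and `2 / (y² - 2)`. An affine relation
between them thus becomes a polynomial of degree at most two in `y`, which cannot have three roots
unless it is zero. -/
lemma cosRatio_four (ho : ‖o‖ = 1) (hk : o ^ 4 ≠ -1) :
    cosRatio 4 1 o * ((2 * o.re) ^ 2 - 2) = 2 * o.re ∧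
      cosRatio 4 2 o * ((2 * o.re) ^ 2 - 2) = 2 := by
  have h1 := cosRatio_recurrence ho hk (l := 0) (by omega)
  have h2 := cosRatio_recurrence ho hk (l := 1) (by omega)
  have h3 := cosRatio_symm (k := 4) (l := 1) (o := o) (by omega)
  have h4 := cosRatio_zero ho hk
  norm_num at h1 h2 h3
  rw [h4] at h1
  constructor
  · linear_combination -h2 + h3 - 2 * o.re * h1
  · linear_combination -2 * h1 - (2 * o.re) * h2 + 2 * o.re * h3

lemma cosRatio_four_independent {o : Fin 3 → ℂ} (ho : ∀ p, ‖o p‖ = 1)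
    (hok : ∀ p, o p ^ 4 ≠ -1) (hre : Function.Injective fun p => (o p).re) {x₀ x₁ x₂ : ℝ}
    (h : ∀ p, x₀ + x₁ * cosRatio 4 1 (o p) + x₂ * cosRatio 4 2 (o p) = 0) :
    x₀ = 0 ∧ x₁ = 0 ∧ x₂ = 0 := by
  have := quadratic_eq_zero (y := fun p => 2 * (o p).re)
    (fun p q hpq => hre (mul_left_cancel₀ two_ne_zero hpq)) (A := x₀) (B := x₁)
    (C := -2 * x₀ + 2 * x₂) (fun p => by
      obtain ⟨h1, h2⟩ := cosRatio_four (ho p) (hok p)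
      linear_combination ((2 * (o p).re) ^ 2 - 2) * h p - x₁ * h1 - x₂ * h2)
  exact ⟨this.1, this.2.1, by linarith [this.1, this.2.2]⟩

/-- Three independent functions on three points span all functions. The case of interest is the
product of the two ratios, which `excluder_eq_zero` needs in linearized form. -/
lemma exists_interpolation {o : Fin 3 → ℂ} (ho : ∀ p, ‖o p‖ = 1)
    (hok : ∀ p, o p ^ 4 ≠ -1) (hre : Function.Injective fun p => (o p).re) (g : Fin 3 → ℝ) :
    ∃ f : Fin 3 → ℝ, ∀ p, g p = f 0 + f 1 * cosRatio 4 1 (o p) + f 2 * cosRatio 4 2 (o p) := by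
  let A : Matrix (Fin 3) (Fin 3) ℝ :=
    fun p => ![1, cosRatio 4 1 (o p), cosRatio 4 2 (o p)]
  have hA : ∀ (f : Fin 3 → ℝ) p,
      A.mulVec f p = f 0 + f 1 * cosRatio 4 1 (o p) + f 2 * cosRatio 4 2 (o p) := by
    intro f p
    simp only [A, Matrix.mulVec, dotProduct, Fin.sum_univ_three, Matrix.cons_val]
    ring
  have hinj : Function.Injective A.mulVec := by
    intro f f' hff
    have h := cosRatio_four_independent ho hok hre (x₀ := f 0 - f' 0) (x₁ := f 1 - f' 1)
      (x₂ := f 2 - f' 2) (fun p => by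
        have := congrFun hff p
        rw [hA, hA] at this
        linear_combination this)
    funext p
    fin_cases p
    · exact sub_eq_zero.mp h.1
    · exact sub_eq_zero.mp h.2.1
    · exact sub_eq_zero.mp h.2.2
  obtain ⟨f, hf⟩ := Matrix.mulVec_surjective_iff_isUnit.mpr
    (Matrix.mulVec_injective_iff_isUnit.mp hinj) g
  exact ⟨f, fun p => by rw [← hA, hf]⟩

end CosRatio

/-! ### Measurements as distances from centres -/

section CrossTerm

/-- The part of `∑ l, u_l u_{k-l} o ^ l` free of `u_0`, `u_k`, divided by `(1 + o ^ k) / 2`. -/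
noncomputable def crossTerm (u : ℕ → ℂ) (k : ℕ) (o : ℂ) : ℂ :=
  ∑ l ∈ Finset.Ico 1 k, u l * u (k - l) * (cosRatio k l o : ℂ)

/-- Averaging the sum with its reversal replaces `o ^ l` by `(o ^ l + o ^ (k - l)) / 2`. The two end
terms have ratio `1` and together give `2 u_0 u_k`. -/
lemma sum_eq_crossTerm (u : ℕ → ℂ) {k : ℕ} (hk : 1 ≤ k) {o : ℂ} (ho : ‖o‖ = 1)
    (hok : o ^ k ≠ -1) :
    ∑ l ∈ Finset.range (k + 1), u l * u (k - l) * o ^ l =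
      (1 + o ^ k) / 2 * (2 * (u 0 * u k) + crossTerm u k o) := by
  have h1 : ∑ l ∈ Finset.range (k + 1), u l * u (k - l) * o ^ l =
      ∑ l ∈ Finset.range (k + 1), u l * u (k - l) * o ^ (k - l) := by
    rw [← Finset.sum_range_reflect]
    refine Finset.sum_congr rfl fun l hl => ?_
    rw [Finset.mem_range] at hl
    rw [show k + 1 - 1 - l = k - l by omega, show k - (k - l) = l by omega]
    ring
  have h2 : ∑ l ∈ Finset.range (k + 1), u l * u (k - l) * o ^ l =
      (1 + o ^ k) / 2 * ∑ l ∈ Finset.range (k + 1), u l * u (k - l) * (cosRatio k l o : ℂ) := by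
    have h3 : ∑ l ∈ Finset.range (k + 1), u l * u (k - l) * o ^ l = 2⁻¹ *
        (∑ l ∈ Finset.range (k + 1), u l * u (k - l) * o ^ l +
          ∑ l ∈ Finset.range (k + 1), u l * u (k - l) * o ^ (k - l)) := by
      rw [← h1]; ring
    rw [h3, ← Finset.sum_add_distrib, Finset.mul_sum, Finset.mul_sum]
    refine Finset.sum_congr rfl fun l hl => ?_
    rw [Finset.mem_range] at hl
    have := cosRatio_mul ho hok (l := l) (by omega)
    linear_combination (-(u l * u (k - l)) / 2) * this
  have h4 : (cosRatio k k o : ℂ) = 1 := by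
    rw [← cosRatio_symm le_rfl, Nat.sub_self, cosRatio_zero ho hok, Complex.ofReal_one]
  rw [h2, Finset.sum_range_succ, Finset.range_eq_Ico, ← Finset.sum_Ioo_add_eq_sum_Ico (by omega)]
  have h5 : Finset.Ioo 0 k = Finset.Ico 1 k := by ext; simp; omega
  rw [h5, crossTerm, h4, cosRatio_zero ho hok, Nat.sub_zero, Nat.sub_self]
  push_cast
  ring

lemma norm_eq_of_fits {N L : ℕ} [NeZero N] {b : ℕ → ℕ → ℝ} {u v : ℕ → ℂ} {k m : ℕ} (hk : 1 ≤ k)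
    (hw : rootW N L ^ (k * m) ≠ -1) (hu : Fits N L b u k m) (hv : Fits N L b v k m) :
    ‖2 * (u 0 * u k) + crossTerm u k (rootW N L ^ m)‖ =
      ‖2 * (v 0 * v k) + crossTerm v k (rootW N L ^ m)‖ := by
  have hN : (N : ℝ) ≠ 0 := NeZero.ne _
  rw [Fits] at hu hv
  have h := hu.symm.trans hv
  have h1 : ∀ l, rootW N L ^ (l * m) = (rootW N L ^ m) ^ l := fun l => by
    rw [mul_comm, pow_mul]
  rw [h1] at hw
  simp only [h1] at h
  rw [sum_eq_crossTerm u hk (norm_rootW_pow L m) hw,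
    sum_eq_crossTerm v hk (norm_rootW_pow L m) hw, norm_mul, norm_mul] at h
  have h2 : ‖(1 + (rootW N L ^ m) ^ k) / 2‖ ≠ 0 := by
    rw [norm_ne_zero_iff]
    exact div_ne_zero (one_add_ne_zero_of_ne_neg_one hw) two_ne_zero
  exact mul_left_cancel₀ h2 (mul_left_cancel₀ (one_div_ne_zero hN) h)

lemma crossTerm_congr {u v : ℕ → ℂ} {k : ℕ} (h : ∀ j, 1 ≤ j → j < k → u j = v j) (o : ℂ) :
    crossTerm u k o = crossTerm v k o := by
  refine Finset.sum_congr rfl fun l hl => ?_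
  rw [Finset.mem_Ico] at hl
  rw [h l hl.1 hl.2, h (k - l) (by omega) (by omega)]

lemma crossTerm_two (u : ℕ → ℂ) (o : ℂ) : crossTerm u 2 o = cosRatio 2 1 o * (u 1 * u 1) := by
  simp [crossTerm, mul_comm]

/-- As at frequency 2, all centres are real multiples of one number, so further shifts cannot
resolve the reflection in their line. -/
lemma crossTerm_three (u : ℕ → ℂ) (o : ℂ) :
    crossTerm u 3 o = cosRatio 3 1 o * (2 * (u 1 * u 2)) := by
  have h := cosRatio_symm (k := 3) (l := 1) (o := o) (by omega)
  norm_num at h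
  have h1 : Finset.Ico 1 3 = {1, 2} := by decide
  rw [crossTerm, h1, Finset.sum_pair (by decide)]
  norm_num [h]
  ring

lemma crossTerm_four (u : ℕ → ℂ) (o : ℂ) : crossTerm u 4 o =
    cosRatio 4 1 o * (2 * (u 1 * u 3)) + cosRatio 4 2 o * (u 2 * u 2) := by
  have h := cosRatio_symm (k := 4) (l := 1) (o := o) (by omega)
  norm_num at h
  simp only [crossTerm, Finset.sum_Ico_eq_sum_range, Finset.sum_range_succ, Finset.sum_range_zero]
  norm_num [h]
  ring

end CrossTerm

/-! ### Intersections of circles in the plane -/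

section Circles

lemma normSq_eq_of_norm_eq {x y : ℂ} (h : ‖x‖ = ‖y‖) : Complex.normSq x = Complex.normSq y := by
  rw [Complex.normSq_eq_norm_sq, Complex.normSq_eq_norm_sq, h]

/-- A point is determined by its distances from three points that are not collinear. -/
lemma eq_of_three_distances {X Y P Q R : ℂ} (hP : ‖X + P‖ = ‖Y + P‖) (hQ : ‖X + Q‖ = ‖Y + Q‖)
    (hR : ‖X + R‖ = ‖Y + R‖) (h : ((Q - P) * (starRingEnd ℂ) (R - P)).im ≠ 0) : X = Y := by
  replace hP := normSq_eq_of_norm_eq hP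
  replace hQ := normSq_eq_of_norm_eq hQ
  replace hR := normSq_eq_of_norm_eq hR
  simp only [Complex.normSq_apply, Complex.add_re, Complex.add_im] at hP hQ hR
  simp only [Complex.mul_im, Complex.conj_re, Complex.conj_im, Complex.sub_re,
    Complex.sub_im] at h
  have h1 : (X.re - Y.re) * (Q.re - P.re) + (X.im - Y.im) * (Q.im - P.im) = 0 := by
    linear_combination (hQ - hP) / 2
  have h2 : (X.re - Y.re) * (R.re - P.re) + (X.im - Y.im) * (R.im - P.im) = 0 := by
    linear_combination (hR - hP) / 2
  have h3 : (X.re - Y.re) * ((Q.re - P.re) * -(R.im - P.im) + (Q.im - P.im) * (R.re - P.re)) =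
      0 := by
    linear_combination (-(R.im - P.im)) * h1 + (Q.im - P.im) * h2
  have h4 : (X.im - Y.im) * ((Q.re - P.re) * -(R.im - P.im) + (Q.im - P.im) * (R.re - P.re)) =
      0 := by
    linear_combination (R.re - P.re) * h1 - (Q.re - P.re) * h2
  exact Complex.ext (sub_eq_zero.mp ((mul_eq_zero.mp h3).resolve_right h))
    (sub_eq_zero.mp ((mul_eq_zero.mp h4).resolve_right h))

/-- A point is determined up to a reflection by its distances from two points of a line. -/
lemma eq_or_eq_reflection {X Y P : ℂ} {s t : ℝ} (hst : s ≠ t) (hP : P ≠ 0)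
    (hs : ‖X + s * P‖ = ‖Y + s * P‖) (ht : ‖X + t * P‖ = ‖Y + t * P‖) :
    X = Y ∨ X * (starRingEnd ℂ) P = (starRingEnd ℂ) Y * P := by
  replace hs := normSq_eq_of_norm_eq hs
  replace ht := normSq_eq_of_norm_eq ht
  simp only [Complex.normSq_apply, Complex.add_re, Complex.add_im, Complex.re_ofReal_mul,
    Complex.im_ofReal_mul] at hs ht
  have hst' : s - t ≠ 0 := sub_ne_zero.mpr hst
  have h1 : (X.re * P.re + X.im * P.im) - (Y.re * P.re + Y.im * P.im) = 0 := by
    have : (s - t) * ((X.re * P.re + X.im * P.im) - (Y.re * P.re + Y.im * P.im)) = 0 := by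
      linear_combination (hs - ht) / 2
    exact (mul_eq_zero.mp this).resolve_left hst'
  have h2 : X.re ^ 2 + X.im ^ 2 = Y.re ^ 2 + Y.im ^ 2 := by
    linear_combination hs - 2 * s * h1
  have h3 : ((X.im * P.re - X.re * P.im) - (Y.im * P.re - Y.re * P.im)) *
      ((X.im * P.re - X.re * P.im) + (Y.im * P.re - Y.re * P.im)) = 0 := by
    linear_combination (P.re ^ 2 + P.im ^ 2) * h2 -
      ((X.re * P.re + X.im * P.im) + (Y.re * P.re + Y.im * P.im)) * h1
  rcases mul_eq_zero.mp h3 with h4 | h4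
  · left
    have hPc : (starRingEnd ℂ) P ≠ 0 := by simpa using hP
    refine mul_right_cancel₀ hPc (Complex.ext ?_ ?_)
    · simp only [Complex.mul_re, Complex.conj_re, Complex.conj_im]; linarith
    · simp only [Complex.mul_im, Complex.conj_re, Complex.conj_im]; linarith
  · right
    refine Complex.ext ?_ ?_
    · simp only [Complex.mul_re, Complex.conj_re, Complex.conj_im]; linarith
    · simp only [Complex.mul_im, Complex.conj_re, Complex.conj_im]; linarith

/-- A polynomial whose nonvanishing excludes the wrong one of two candidates for `u₃`. -/
def excluder (f : Fin 3 → ℝ) (S T Y : ℂ) (C : ℝ) : ℝ :=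
  T.im ^ 2 * (Y.re - (T.re - S.re) * f 2) ^ 2 +
    (Y.re * (S.re - T.re) + Y.im * S.im - C * (T.re - S.re) * f 1 +
      (T.re - S.re) * f 2 * T.re) ^ 2 -
    T.im ^ 2 * (Y.re ^ 2 + Y.im ^ 2) + 2 * T.im ^ 2 * C * (T.re - S.re) * f 0

lemma excluder_conj (f : Fin 3 → ℝ) (S T Y : ℂ) (C : ℝ) :
    excluder f ((starRingEnd ℂ) S) ((starRingEnd ℂ) T) ((starRingEnd ℂ) Y) C =
      excluder f S T Y C := by
  simp only [excluder, Complex.conj_re, Complex.conj_im]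
  ring

/-- In the squared equations the `α²` terms cancel since `|S| = |T|`, and the `β²` terms since `C`
is common. Linearizing `αβ` through `f` leaves an affine relation in `α, β`, whose three
coefficients must vanish. The `β` coefficient gives `X.re`, the `α` coefficient gives `T.im * X.im`,
and the constant one, multiplied by `T.im ^ 2`, then no longer involves `X`. -/
lemma excluder_eq_zero {α β : Fin 3 → ℝ} {f : Fin 3 → ℝ} {S T X Y : ℂ} {C : ℝ} (hC : C ≠ 0)
    (hf : ∀ p, α p * β p = f 0 + f 1 * α p + f 2 * β p)
    (hind : ∀ x₀ x₁ x₂ : ℝ, (∀ p, x₀ + x₁ * α p + x₂ * β p = 0) → x₀ = 0 ∧ x₁ = 0 ∧ x₂ = 0)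
    (hST : Complex.normSq S = Complex.normSq T)
    (h : ∀ p, ‖X + (α p * T + β p * C)‖ = ‖Y + (α p * S + β p * C)‖) :
    excluder f S T Y C = 0 := by
  simp only [Complex.normSq_apply] at hST
  obtain ⟨h0, h1, h2⟩ := hind
    (X.re ^ 2 + X.im ^ 2 - Y.re ^ 2 - Y.im ^ 2 + 2 * C * (T.re - S.re) * f 0)
    (2 * (X.re * T.re + X.im * T.im - Y.re * S.re - Y.im * S.im) + 2 * C * (T.re - S.re) * f 1)
    (2 * C * (X.re - Y.re) + 2 * C * (T.re - S.re) * f 2) (fun p => by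
      have h3 := normSq_eq_of_norm_eq (h p)
      simp only [Complex.normSq_apply, Complex.add_re, Complex.add_im, Complex.re_ofReal_mul,
        Complex.im_ofReal_mul, Complex.ofReal_re, Complex.ofReal_im] at h3
      linear_combination h3 - 2 * C * (T.re - S.re) * hf p + (α p) ^ 2 * hST)
  have h4 : X.re - Y.re + (T.re - S.re) * f 2 = 0 := by
    have : (2 * C) * (X.re - Y.re + (T.re - S.re) * f 2) = 0 := by linear_combination h2
    exact (mul_eq_zero.mp this).resolve_left (mul_ne_zero two_ne_zero hC)
  have h5 : X.re = Y.re - (T.re - S.re) * f 2 := by linear_combination h4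
  rw [h5] at h0 h1
  have h6 : T.im * X.im = Y.re * (S.re - T.re) + Y.im * S.im - C * (T.re - S.re) * f 1 +
      (T.re - S.re) * f 2 * T.re := by linear_combination h1 / 2
  rw [excluder, ← h6]
  linear_combination T.im ^ 2 * h0

end Circles

/-! ### Nondegenerate spectra and their invariance -/

section Uniqueness

/-- Two positive shifts that together with the shift `0` are admissible at frequency `k`. -/
structure AdmissiblePair (N L k i j : ℕ) : Prop where
  left_lt : i < numShifts N L
  right_lt : j < numShifts N L
  left_ne_zero : i ≠ 0
  right_ne_zero : j ≠ 0
  ne : i ≠ j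
  add_ne : i + j ≠ numShifts N L
  left_pow : rootW N L ^ (k * i) ≠ -1
  right_pow : rootW N L ^ (k * j) ≠ -1

/-- The points `w ^ m` for the shifts `m = 0, i, j`. -/
noncomputable def shiftPoints (N L i j : ℕ) : Fin 3 → ℂ :=
  ![rootW N L ^ 0, rootW N L ^ i, rootW N L ^ j]

variable {N L : ℕ}

lemma norm_shiftPoints [NeZero N] (i j : ℕ) (p : Fin 3) : ‖shiftPoints N L i j p‖ = 1 := by
  fin_cases p <;> simp only [shiftPoints] <;> exact norm_rootW_pow _ _

lemma AdmissiblePair.pow_ne {k i j : ℕ} (h : AdmissiblePair N L k i j) (p : Fin 3) :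
    shiftPoints N L i j p ^ k ≠ -1 := by
  have h1 := h.left_pow
  have h2 := h.right_pow
  rw [mul_comm, pow_mul] at h1 h2
  fin_cases p
  · simp only [shiftPoints, Fin.zero_eta, Matrix.cons_val_zero, pow_zero, one_pow]
    norm_num
  · exact h1
  · exact h2

lemma AdmissiblePair.re_injective [NeZero N] (hL : 0 < L) {k i j : ℕ}
    (h : AdmissiblePair N L k i j) :
    Function.Injective fun p => (shiftPoints N L i j p).re := by
  have h0 : 0 < numShifts N L := lt_of_le_of_lt (Nat.zero_le _) h.left_lt
  have h1 := h.left_lt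
  have h2 := h.right_lt
  have e1 := rootW_pow_re_ne hL h0 h1 (Ne.symm h.left_ne_zero) (by omega)
  have e2 := rootW_pow_re_ne hL h0 h2 (Ne.symm h.right_ne_zero) (by omega)
  have e3 := rootW_pow_re_ne hL h1 h2 h.ne h.add_ne
  intro p q hpq
  fin_cases p <;> fin_cases q <;> first | rfl | skip
  · exact absurd hpq e1
  · exact absurd hpq e2
  · exact absurd hpq e1.symm
  · exact absurd hpq e3
  · exact absurd hpq e2.symm
  · exact absurd hpq e3.symm

/-- The signed area spanned by the cross terms at three points. -/
noncomputable def spread (v : ℕ → ℂ) (k : ℕ) (o : Fin 3 → ℂ) : ℝ :=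
  ((crossTerm v k (o 1) - crossTerm v k (o 0)) *
    (starRingEnd ℂ) (crossTerm v k (o 2) - crossTerm v k (o 0))).im

/-- The value of `excluder` at a spectrum, normalized so as to be a polynomial. -/
noncomputable def spectrumExcluder (f : Fin 3 → ℝ) (v : ℕ → ℂ) : ℝ :=
  excluder f
    (Complex.normSq (v 1) * (2 * (v 1 * v 3) * (starRingEnd ℂ) (v 2) ^ 2))
    (2 * v 1 ^ 3 * (starRingEnd ℂ) (v 3) * Complex.normSq (v 2))
    (Complex.normSq (v 1) * (2 * (v 0 * v 4) * (starRingEnd ℂ) (v 2) ^ 2))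
    (Complex.normSq (v 1) * Complex.normSq (v 2) ^ 2)

/-- The conditions on a spectrum under which it can be recovered. -/
structure NonDegenerate (N L M : ℕ) (v : ℕ → ℂ) : Prop where
  two_ne_zero : v 2 ≠ 0
  spread_ne_zero : ∀ k ∈ Finset.Icc 4 M, ∀ i j, AdmissiblePair N L k i j →
    spread v k (shiftPoints N L i j) ≠ 0
  excluder_ne_zero : ∀ i j, AdmissiblePair N L 4 i j → ∃ f : Fin 3 → ℝ,
    (∀ p, cosRatio 4 1 (shiftPoints N L i j p) * cosRatio 4 2 (shiftPoints N L i j p) =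
      f 0 + f 1 * cosRatio 4 1 (shiftPoints N L i j p) +
        f 2 * cosRatio 4 2 (shiftPoints N L i j p)) ∧
    spectrumExcluder f v ≠ 0

lemma crossTerm_conj (v : ℕ → ℂ) (k : ℕ) (o : ℂ) :
    crossTerm (fun j => (starRingEnd ℂ) (v j)) k o = (starRingEnd ℂ) (crossTerm v k o) := by
  simp only [crossTerm, map_sum, map_mul, Complex.conj_ofReal]

lemma spread_conj (v : ℕ → ℂ) (k : ℕ) (o : Fin 3 → ℂ) :
    spread (fun j => (starRingEnd ℂ) (v j)) k o = -spread v k o := by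
  simp only [spread, crossTerm_conj, ← map_sub, ← map_mul, Complex.conj_im]

lemma spectrumExcluder_conj (f : Fin 3 → ℝ) (v : ℕ → ℂ) :
    spectrumExcluder f (fun j => (starRingEnd ℂ) (v j)) = spectrumExcluder f v := by
  rw [spectrumExcluder, spectrumExcluder, ← excluder_conj]
  simp only [Complex.normSq_conj, map_mul, map_pow, Complex.conj_ofReal, Complex.conj_conj,
    map_ofNat]

lemma NonDegenerate.conj {M : ℕ} {v : ℕ → ℂ} (h : NonDegenerate N L M v) :
    NonDegenerate N L M (fun j => (starRingEnd ℂ) (v j)) := by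
  refine ⟨?_, fun k hk i j hij => ?_, fun i j hij => ?_⟩
  · simpa using h.two_ne_zero
  · rw [spread_conj]; exact neg_ne_zero.mpr (h.spread_ne_zero k hk i j hij)
  · obtain ⟨f, hf, hne⟩ := h.excluder_ne_zero i j hij
    exact ⟨f, hf, by rwa [spectrumExcluder_conj]⟩

/-- All cross terms at frequency `k` are multiplied by the same rotation `e ^ k`, which preserves
area. -/
lemma spread_of_proportional {v a : ℕ → ℂ} {s e : ℂ} (hs : s = 1 ∨ s = -1) (he : ‖e‖ = 1)
    {k : ℕ} (h : ∀ j ≤ k, v j = s * a j * e ^ j) (o : Fin 3 → ℂ) :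
    spread v k o = spread a k o := by
  have hss : s * s = 1 := by rcases hs with rfl | rfl <;> norm_num
  have hc : ∀ x, crossTerm v k x = e ^ k * crossTerm a k x := by
    intro x
    rw [crossTerm, crossTerm, Finset.mul_sum]
    refine Finset.sum_congr rfl fun l hl => ?_
    rw [Finset.mem_Ico] at hl
    rw [h l hl.2.le, h (k - l) (Nat.sub_le _ _), ← pow_sub_mul_pow e hl.2.le]
    linear_combination (a l * a (k - l) * e ^ (k - l) * e ^ l * (cosRatio k l x : ℂ)) * hss
  have he2 : e ^ k * (starRingEnd ℂ) (e ^ k) = 1 := by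
    rw [Complex.mul_conj, Complex.normSq_eq_norm_sq, norm_pow, he]; simp
  rw [spread, spread, hc, hc, hc, ← mul_sub, ← mul_sub, map_mul,
    show ∀ A B C D : ℂ, A * B * (C * D) = A * C * (B * D) by intros; ring, he2, one_mul]

/-- The arguments of `excluder` have phase weight zero, namely `1 + 3 - 2·2`, `3·1 - 3` and `0 + 4 -
2·2`, and contain the sign to an even power. -/
lemma spectrumExcluder_of_proportional {v a : ℕ → ℂ} {s e : ℂ} (hs : s = 1 ∨ s = -1)
    (he : ‖e‖ = 1) (h : ∀ j ≤ 4, v j = s * a j * e ^ j) (f : Fin 3 → ℝ) :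
    spectrumExcluder f v = spectrumExcluder f a := by
  have hss : s ^ 2 = 1 := by rcases hs with rfl | rfl <;> norm_num
  have hsc : (starRingEnd ℂ) s = s := by rcases hs with rfl | rfl <;> simp
  have hsn : Complex.normSq s = 1 := by rcases hs with rfl | rfl <;> simp
  have hen : Complex.normSq e = 1 := by rw [Complex.normSq_eq_norm_sq, he]; simp
  have hee : e * (starRingEnd ℂ) e = 1 := by rw [Complex.mul_conj, hen]; simp
  have hs4 : s ^ 4 = 1 := by rw [show s ^ 4 = (s ^ 2) ^ 2 by ring, hss, one_pow]
  have h0 := h 0 (by omega)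
  have h1 := h 1 (by omega)
  have h2 := h 2 (by omega)
  have h3 := h 3 (by omega)
  have h4 := h 4 (by omega)
  have he3 : e ^ 3 * (starRingEnd ℂ) e ^ 3 = 1 := by rw [← mul_pow, hee, one_pow]
  have he4 : e ^ 4 * (starRingEnd ℂ) e ^ 4 = 1 := by rw [← mul_pow, hee, one_pow]
  have hs4e4 : s ^ 4 * (e ^ 4 * (starRingEnd ℂ) e ^ 4) = 1 := by rw [hs4, he4, one_mul]
  have hs4e3 : s ^ 4 * (e ^ 3 * (starRingEnd ℂ) e ^ 3) = 1 := by rw [hs4, he3, one_mul]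
  have n1 : Complex.normSq (v 1) = Complex.normSq (a 1) := by
    rw [h1]; simp [hsn, hen]
  have n2 : Complex.normSq (v 2) = Complex.normSq (a 2) := by
    rw [h2]; simp [hsn, hen]
  rw [spectrumExcluder, spectrumExcluder, n1, n2, h0, h1, h2, h3, h4]
  simp only [map_mul, map_pow, hsc]
  congr 1
  · linear_combination (Complex.normSq (a 1) * (2 * (a 1 * a 3) *
      (starRingEnd ℂ) (a 2) ^ 2)) * hs4e4
  · linear_combination (2 * a 1 ^ 3 * (starRingEnd ℂ) (a 3) * Complex.normSq (a 2)) * hs4e3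
  · linear_combination (Complex.normSq (a 1) * (2 * (a 0 * a 4) *
      (starRingEnd ℂ) (a 2) ^ 2)) * hs4e4

lemma NonDegenerate.of_proportional {M : ℕ} (hM : 4 ≤ M) {v a : ℕ → ℂ} {s e : ℂ}
    (hs : s = 1 ∨ s = -1) (he : ‖e‖ = 1) (h : ∀ j ≤ M, v j = s * a j * e ^ j)
    (ha : NonDegenerate N L M a) : NonDegenerate N L M v := by
  have he0 : e ≠ 0 := by rw [← norm_ne_zero_iff, he]; exact one_ne_zero
  have hs0 : s ≠ 0 := by rcases hs with rfl | rfl <;> norm_num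
  refine ⟨?_, fun k hk i j hij => ?_, fun i j hij => ?_⟩
  · rw [h 2 (by omega)]
    exact mul_ne_zero (mul_ne_zero hs0 ha.two_ne_zero) (pow_ne_zero _ he0)
  · rw [spread_of_proportional hs he fun l hl => h l (hl.trans (Finset.mem_Icc.mp hk).2)]
    exact ha.spread_ne_zero k hk i j hij
  · obtain ⟨f, hf, hne⟩ := ha.excluder_ne_zero i j hij
    refine ⟨f, hf, ?_⟩
    rwa [spectrumExcluder_of_proportional hs he fun l hl => h l (hl.trans hM)]

lemma Shifts.Admissible.pair {I : Shifts} (hI : I.Admissible N L) {k : ℕ} (hk : 4 ≤ k)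
    (hkN : k ≤ N / 2) : AdmissiblePair N L k (I.ik k 1) (I.ik k 2) := by
  have h0 := hI.ik_first k hk hkN
  have hinj := hI.ik_injective k hk hkN
  exact ⟨hI.ik_lt k hk hkN 1, hI.ik_lt k hk hkN 2, by rw [← h0]; exact hinj.ne (by decide),
    by rw [← h0]; exact hinj.ne (by decide), hinj.ne (by decide), hI.ik_sum k hk hkN,
    hI.ik_ne k hk hkN 1, hI.ik_ne k hk hkN 2⟩

lemma Shifts.Admissible.shiftPoints_eq {I : Shifts} (hI : I.Admissible N L) {k : ℕ} (hk : 4 ≤ k)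
    (hkN : k ≤ N / 2) (p : Fin 3) :
    shiftPoints N L (I.ik k 1) (I.ik k 2) p = rootW N L ^ I.ik k p := by
  fin_cases p
  · exact congrArg (rootW N L ^ ·) (hI.ik_first k hk hkN).symm
  · rfl
  · rfl

end Uniqueness

/-! ### Every state follows the spectrum or its conjugate -/

section Recovery

variable {N L : ℕ} {I : Shifts} {b : ℕ → ℕ → ℝ}

lemma rootW_pow_mul_zero_ne (k : ℕ) : rootW N L ^ (k * 0) ≠ -1 := by
  rw [mul_zero, pow_zero]; norm_num

lemma Fits.congr {u v : ℕ → ℂ} {k m : ℕ} (h : ∀ j ≤ k, u j = v j) (hu : Fits N L b u k m) :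
    Fits N L b v k m := by
  rw [Fits] at hu ⊢
  rw [hu]
  congr 2
  refine Finset.sum_congr rfl fun l hl => ?_
  rw [Finset.mem_range] at hl
  rw [h l (by omega), h (k - l) (by omega)]

lemma IsState.truncate {n n' : ℕ} {v : ℕ → ℂ} (hn : 2 ≤ n) (hnn : n ≤ n')
    (hv : IsState N L I b n' v) : IsState N L I b n (fun j => if j ≤ n then v j else 0) := by
  have hf : ∀ k ≤ n, ∀ m, Fits N L b v k m →
      Fits N L b (fun j => if j ≤ n then v j else 0) k m := fun k hk m h =>
    h.congr fun j hj => by rw [if_pos (hj.trans hk)]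
  refine ⟨?_, ?_, ?_, fun h4 => ?_, fun j hj hjn p => ?_, fun j hj => ?_⟩
  · simpa using hv.entry_zero
  · simpa [show 1 ≤ n by omega] using hv.entry_one
  · exact ⟨hf 2 hn _ hv.step_one.1, hf 2 hn _ hv.step_one.2⟩
  · obtain ⟨h1, h2, h3⟩ := hv.step_two (h4.trans hnn)
    exact ⟨hf 3 (by omega) _ h1, hf 3 (by omega) _ h2, fun p => hf 4 h4 _ (h3 p)⟩
  · exact hf j hjn _ (hv.step_three j hj (hjn.trans hnn) p)
  · rw [if_neg (by omega)]

variable [NeZero N]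

/-- The ratio at the shift `0` is `1`. This lets the conditions `i2_second` and `i3_ratio` be read
as saying that the two centres at frequency 2, respectively 3, are distinct. -/
lemma cosRatio_rootW_ne_one {k l m : ℕ} (hl : l ≤ k)
    (h : (rootW N L ^ m) ^ l + (rootW N L ^ m) ^ (k - l) ≠ 1 + (rootW N L ^ m) ^ k)
    (hk : rootW N L ^ (k * m) ≠ -1) :
    cosRatio k l (rootW N L ^ 0) ≠ cosRatio k l (rootW N L ^ m) := by
  intro he
  have h1 : cosRatio k l (rootW N L ^ 0) = 1 := by
    rw [pow_zero, cosRatio]; norm_num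
  rw [mul_comm, pow_mul] at hk
  have h2 := cosRatio_mul (norm_rootW_pow L m) hk hl
  rw [← he, h1, Complex.ofReal_one, one_mul] at h2
  exact h h2.symm

lemma Shifts.Admissible.cosRatio_two_ne (hI : I.Admissible N L) :
    cosRatio 2 1 (rootW N L ^ 0) ≠ cosRatio 2 1 (rootW N L ^ I.i2 1) := by
  have h1 := hI.i2_ne 1
  refine cosRatio_rootW_ne_one (by omega) (fun h => hI.i2_second ?_) h1
  have h2 : 1 + rootW N L ^ (2 * I.i2 1) ≠ 0 := one_add_ne_zero_of_ne_neg_one h1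
  rw [mul_comm, pow_mul] at h2 ⊢
  norm_num at h
  rw [div_eq_div_iff h2 two_ne_zero]
  linear_combination h

lemma Shifts.Admissible.cosRatio_three_ne (hI : I.Admissible N L) :
    cosRatio 3 1 (rootW N L ^ 0) ≠ cosRatio 3 1 (rootW N L ^ I.i3) := by
  have h1 := hI.i3_ne
  refine cosRatio_rootW_ne_one (by omega) (fun h => hI.i3_ratio ?_) h1
  have h2 : 1 + rootW N L ^ (3 * I.i3) ≠ 0 := one_add_ne_zero_of_ne_neg_one h1
  rw [mul_comm 3, pow_mul] at h2
  rw [mul_comm 3, mul_comm 2, pow_mul, pow_mul]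
  norm_num at h
  rw [div_eq_one_iff_eq h2]
  exact h

/-- The second entry is determined up to complex conjugation. -/
lemma IsState.entry_two {n n' : ℕ} {u v : ℕ → ℂ} (hI : I.Admissible N L)
    (hu : IsState N L I b n u) (hv : IsState N L I b n' v) (hv0 : v 0 ≠ 0) (hv1 : v 1 ≠ 0) :
    u 2 = v 2 ∨ u 2 = (starRingEnd ℂ) (v 2) := by
  have e0 : u 0 = v 0 := hu.entry_zero.trans hv.entry_zero.symm
  have e1 : u 1 = v 1 := hu.entry_one.trans hv.entry_one.symm
  have c0 : (starRingEnd ℂ) (v 0) = v 0 := by rw [hv.entry_zero, Complex.conj_ofReal]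
  have c1 : (starRingEnd ℂ) (v 1) = v 1 := by rw [hv.entry_one, Complex.conj_ofReal]
  have h1 := norm_eq_of_fits (by omega) (rootW_pow_mul_zero_ne 2) hu.step_one.1 hv.step_one.1
  have h2 := norm_eq_of_fits (by omega) (hI.i2_ne 1) hu.step_one.2 hv.step_one.2
  simp only [crossTerm_two, e0, e1] at h1 h2
  have hP : v 1 * v 1 ≠ 0 := mul_ne_zero hv1 hv1
  have h20 : 2 * v 0 ≠ 0 := mul_ne_zero two_ne_zero hv0
  -- Since `v 1 * v 1` is real, the reflection in the line of centres is complex conjugation.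
  rcases eq_or_eq_reflection hI.cosRatio_two_ne hP h1 h2 with h | h
  · left
    exact mul_left_cancel₀ h20 (by linear_combination h)
  · right
    simp only [map_mul, c0, c1, map_ofNat] at h
    exact mul_left_cancel₀ h20 (mul_right_cancel₀ hP (by linear_combination h))

/-- Agreement below `k` gives both sequences the same three centres, and a nonzero spread says that
these are not collinear. -/
lemma IsState.eq_of_spread {u v : ℕ → ℂ} {k : ℕ} (hI : I.Admissible N L) (hk : 4 ≤ k)
    (hkN : k ≤ N / 2) (hu : ∀ p, Fits N L b u k (I.ik k p)) (hv : ∀ p, Fits N L b v k (I.ik k p))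
    (hv0 : v 0 ≠ 0) (h : ∀ j < k, u j = v j)
    (hs : spread v k (shiftPoints N L (I.ik k 1) (I.ik k 2)) ≠ 0) : u k = v k := by
  have hn := fun p => norm_eq_of_fits (by omega) (hI.ik_ne k hk hkN p) (hu p) (hv p)
  have hc : ∀ x, crossTerm u k x = crossTerm v k x := crossTerm_congr fun j _ hj => h j hj
  simp only [h 0 (by omega), hc, ← hI.shiftPoints_eq hk hkN] at hn
  have := eq_of_three_distances (hn 0) (hn 1) (hn 2) hs
  exact mul_left_cancel₀ hv0 (mul_left_cancel₀ two_ne_zero this)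

/-- Frequency 3 allows `v 3` and its mirror image in the line of `v 2`. If the two differ and the
mirror image extends by some `u 4` solving the equations at frequency 4, the excluder of `v`
vanishes. -/
lemma IsState.entry_three {n n' : ℕ} {u v : ℕ → ℂ} (hI : I.Admissible N L) (hL : 0 < L)
    (hN : 4 ≤ N / 2) (hu : IsState N L I b n u) (hn : 4 ≤ n) (hv : IsState N L I b n' v)
    (hn' : 4 ≤ n') (hv0 : v 0 ≠ 0) (hv1 : v 1 ≠ 0) (h2 : u 2 = v 2)
    (hnd : NonDegenerate N L (N / 2) v) : u 3 = v 3 := by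
  have e0 : u 0 = v 0 := hu.entry_zero.trans hv.entry_zero.symm
  have e1 : u 1 = v 1 := hu.entry_one.trans hv.entry_one.symm
  have c0 : (starRingEnd ℂ) (v 0) = v 0 := by rw [hv.entry_zero, Complex.conj_ofReal]
  have c1 : (starRingEnd ℂ) (v 1) = v 1 := by rw [hv.entry_one, Complex.conj_ofReal]
  have hv2 := hnd.two_ne_zero
  obtain ⟨hu3, hu3', hu4⟩ := hu.step_two hn
  obtain ⟨hv3, hv3', hv4⟩ := hv.step_two hn'
  have h1 := norm_eq_of_fits (by omega) (rootW_pow_mul_zero_ne 3) hu3 hv3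
  have h3 := norm_eq_of_fits (by omega) hI.i3_ne hu3' hv3'
  simp only [crossTerm_three, e0, e1, h2] at h1 h3
  have hP : 2 * (v 1 * v 2) ≠ 0 := mul_ne_zero two_ne_zero (mul_ne_zero hv1 hv2)
  have h20 : 2 * v 0 ≠ 0 := mul_ne_zero two_ne_zero hv0
  rcases eq_or_eq_reflection hI.cosRatio_three_ne hP h1 h3 with h | h
  · exact mul_left_cancel₀ h20 (by linear_combination h)
  · exfalso
    simp only [map_mul, c0, c1, map_ofNat] at h
    have hg : u 3 * (starRingEnd ℂ) (v 2) = (starRingEnd ℂ) (v 3) * v 2 := by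
      refine mul_left_cancel₀ (mul_ne_zero h20 (mul_ne_zero two_ne_zero hv1)) ?_
      linear_combination h
    have hpair := hI.pair le_rfl hN
    obtain ⟨f, hf, hne⟩ := hnd.excluder_ne_zero _ _ hpair
    refine hne ?_
    have hB : v 2 * (starRingEnd ℂ) (v 2) = (Complex.normSq (v 2) : ℂ) := Complex.mul_conj _
    have hA : v 1 * v 1 = (Complex.normSq (v 1) : ℂ) := by
      rw [← Complex.mul_conj, c1]
    -- Multiplying the equations at frequency 4 by `|v 1|² conj(v 2)²` makes the coefficient of `β`
    -- real and common to both sides. It also lets `hg` express the coefficient containing `u 3`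
    -- through `v` alone, so that `u 4` is the only foreign unknown.
    refine excluder_eq_zero (α := fun p => cosRatio 4 1 (shiftPoints N L (I.ik 4 1) (I.ik 4 2) p))
      (β := fun p => cosRatio 4 2 (shiftPoints N L (I.ik 4 1) (I.ik 4 2) p))
      (X := Complex.normSq (v 1) * (2 * (v 0 * u 4) * (starRingEnd ℂ) (v 2) ^ 2))
      ?_ hf ?_ ?_ ?_
    · exact mul_ne_zero (Complex.normSq_eq_zero.not.mpr hv1)
        (pow_ne_zero _ (Complex.normSq_eq_zero.not.mpr hv2))
    · intro x₀ x₁ x₂ hx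
      exact cosRatio_four_independent (norm_shiftPoints _ _) hpair.pow_ne
        (hpair.re_injective hL) hx
    · simp only [map_mul, map_pow, Complex.normSq_conj, Complex.normSq_ofReal]
      ring
    · intro p
      have hq := norm_eq_of_fits (by omega) (hI.ik_ne 4 le_rfl hN p) (hu4 p) (hv4 p)
      simp only [crossTerm_four, e0, e1, h2, ← hI.shiftPoints_eq le_rfl hN] at hq
      have hm := congrArg
        (fun x => ‖(Complex.normSq (v 1) : ℂ) * (starRingEnd ℂ) (v 2) ^ 2‖ * x) hq
      simp only [← norm_mul] at hm
      generalize cosRatio 4 1 (shiftPoints N L (I.ik 4 1) (I.ik 4 2) p) = α at hm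
      generalize cosRatio 4 2 (shiftPoints N L (I.ik 4 1) (I.ik 4 2) p) = β at hm
      have key : ∀ x y : ℂ, (Complex.normSq (v 1) : ℂ) * (starRingEnd ℂ) (v 2) ^ 2 *
          (2 * (v 0 * x) + (α * (2 * (v 1 * y)) + β * (v 2 * v 2))) =
          Complex.normSq (v 1) * (2 * (v 0 * x) * (starRingEnd ℂ) (v 2) ^ 2) +
          (α * (Complex.normSq (v 1) * (2 * (v 1 * y) * (starRingEnd ℂ) (v 2) ^ 2)) +
          β * ((Complex.normSq (v 1) * Complex.normSq (v 2) ^ 2 : ℝ) : ℂ)) := by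
        intro x y
        rw [Complex.ofReal_mul, Complex.ofReal_pow, ← hB]
        ring
      rw [key, key] at hm
      convert hm using 5
      rw [← hA, ← hB]
      linear_combination (-2 * v 1 ^ 3 * (starRingEnd ℂ) (v 2)) * hg

/-- The algorithm recovers a nondegenerate spectrum once `u_2` is chosen correctly. -/
theorem IsState.eq_of_entry_two {n : ℕ} {u v : ℕ → ℂ} (hI : I.Admissible N L) (hL : 0 < L)
    (hN : 4 ≤ N / 2) (hu : IsState N L I b n u) (hn3 : n ≠ 3) (hnN : n ≤ N / 2)
    (hv : IsState N L I b (N / 2) v) (hv0 : v 0 ≠ 0) (hv1 : v 1 ≠ 0) (h2 : u 2 = v 2)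
    (hnd : NonDegenerate N L (N / 2) v) : ∀ j ≤ n, u j = v j := by
  have e0 : u 0 = v 0 := hu.entry_zero.trans hv.entry_zero.symm
  have e1 : u 1 = v 1 := hu.entry_one.trans hv.entry_one.symm
  intro j
  induction j using Nat.strong_induction_on with
  | _ j ih =>
    intro hj
    rcases Nat.lt_or_ge j 4 with h4 | h4
    · interval_cases j
      · exact e0
      · exact e1
      · exact h2
      · exact hu.entry_three hI hL hN (by omega) hv hN hv0 hv1 h2 hnd
    · refine IsState.eq_of_spread hI h4 (hj.trans hnN) (b := b) ?_ ?_ hv0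
        (fun i hi => ih i hi (by omega))
        (hnd.spread_ne_zero j (Finset.mem_Icc.mpr ⟨h4, hj.trans hnN⟩) _ _
          (hI.pair h4 (hj.trans hnN)))
      · rcases h4.eq_or_lt with rfl | h5
        · exact (hu.step_two hj).2.2
        · exact hu.step_three j h5 hj
      · rcases h4.eq_or_lt with rfl | h5
        · exact (hv.step_two hN).2.2
        · exact hv.step_three j h5 (hj.trans hnN)

/-- Conjugation inverts `w^{lm}`; the unimodular factor `w^{km}` and the reversal `l ↦ k - l`
restore the original weights. -/
lemma Fits.conj {v : ℕ → ℂ} {k m : ℕ} (h : Fits N L b v k m) :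
    Fits N L b (fun j => (starRingEnd ℂ) (v j)) k m := by
  rw [Fits] at h ⊢
  rw [h]
  congr 1
  set o := rootW N L ^ m with ho
  have ho1 : ‖o‖ = 1 := norm_rootW_pow L m
  have hoc : (starRingEnd ℂ) o * o = 1 := by
    rw [mul_comm, Complex.mul_conj, Complex.normSq_eq_norm_sq, ho1]; norm_num
  have hpow : ∀ l, rootW N L ^ (l * m) = o ^ l := fun l => by rw [mul_comm, pow_mul]
  simp only [hpow]
  rw [← one_mul ‖∑ l ∈ Finset.range (k + 1), v l * v (k - l) * o ^ l‖,
    ← RCLike.norm_conj (∑ l ∈ Finset.range (k + 1), v l * v (k - l) * o ^ l),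
    ← one_pow k, ← ho1, ← norm_pow, ← norm_mul, map_sum, Finset.mul_sum,
    ← Finset.sum_range_reflect]
  congr 1
  refine Finset.sum_congr rfl fun l hl => ?_
  rw [Finset.mem_range] at hl
  rw [show k + 1 - 1 - l = k - l by omega, show k - (k - l) = l by omega, map_mul, map_mul,
    map_pow]
  have h1 : o ^ k * (starRingEnd ℂ) o ^ (k - l) = o ^ l := by
    rw [← pow_mul_pow_sub o (show l ≤ k by omega), mul_assoc, ← mul_pow, mul_comm o, hoc, one_pow,
      mul_one]
  rw [← h1]
  ring

lemma IsState.conj {n : ℕ} {v : ℕ → ℂ} (hv : IsState N L I b n v) :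
    IsState N L I b n (fun j => (starRingEnd ℂ) (v j)) := by
  refine ⟨?_, ?_, ?_, fun h4 => ?_, fun j hj hjn p => ?_, fun j hj => ?_⟩
  · rw [hv.entry_zero, Complex.conj_ofReal]
  · rw [hv.entry_one, Complex.conj_ofReal]
  · exact ⟨Fits.conj hv.step_one.1, Fits.conj hv.step_one.2⟩
  · obtain ⟨h1, h2, h3⟩ := hv.step_two h4
    exact ⟨Fits.conj h1, Fits.conj h2, fun p => Fits.conj (h3 p)⟩
  · exact Fits.conj (hv.step_three j hj hjn p)
  · rw [hv.tail j hj, map_zero]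

/-- Every state is a truncation of the spectrum or of its conjugate. -/
theorem IsState.eq_or_eq_conj {n : ℕ} {u v : ℕ → ℂ} (hI : I.Admissible N L) (hL : 0 < L)
    (hN : 4 ≤ N / 2) (hu : IsState N L I b n u) (hn3 : n ≠ 3) (hnN : n ≤ N / 2)
    (hv : IsState N L I b (N / 2) v) (hv0 : v 0 ≠ 0) (hv1 : v 1 ≠ 0)
    (hnd : NonDegenerate N L (N / 2) v) :
    (∀ j ≤ n, u j = v j) ∨ ∀ j ≤ n, u j = (starRingEnd ℂ) (v j) := by
  rcases hu.entry_two hI hv hv0 hv1 with h | h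
  · exact Or.inl (hu.eq_of_entry_two hI hL hN hn3 hnN hv hv0 hv1 h hnd)
  · exact Or.inr (hu.eq_of_entry_two hI hL hN hn3 hnN hv.conj (by simpa using hv0)
      (by simpa using hv1) h hnd.conj)

/-- A state extends in exactly one way to a complete one. -/
theorem IsState.existsUnique_extension {n : ℕ} {u v : ℕ → ℂ} (hI : I.Admissible N L)
    (hL : 0 < L) (hN : 4 ≤ N / 2) (hu : IsState N L I b n u) (hn : 2 ≤ n) (hn3 : n ≠ 3)
    (hnN : n ≤ N / 2) (hv : IsState N L I b (N / 2) v) (hv0 : v 0 ≠ 0) (hv1 : v 1 ≠ 0)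
    (hnd : NonDegenerate N L (N / 2) v) :
    ∃! v' : ℕ → ℂ, IsState N L I b (N / 2) v' ∧ ∀ j ≤ n, v' j = u j := by
  -- If `u` follows the conjugate instead, `v` may be replaced by its conjugate, which is again a
  -- complete nondegenerate state.
  wlog h : ∀ j ≤ n, u j = v j generalizing v
  · exact this hv.conj (by simpa using hv0) (by simpa using hv1) hnd.conj
      ((hu.eq_or_eq_conj hI hL hN hn3 hnN hv hv0 hv1 hnd).resolve_left h)
  refine ⟨v, ⟨hv, fun j hj => (h j hj).symm⟩, fun v' ⟨hv', hvu⟩ => ?_⟩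
  have h2 : v' 2 = v 2 := (hvu 2 hn).trans (h 2 hn)
  have hle := hv'.eq_of_entry_two hI hL hN (by omega) le_rfl hv hv0 hv1 h2 hnd
  funext j
  rcases le_or_gt j (N / 2) with hj | hj
  · exact hle j hj
  · rw [hv'.tail j hj, hv.tail j hj]

end Recovery

/-! ### Normal forms and the final phase correction -/

section NormalForm

variable {N L : ℕ} [NeZero N]

/-- `v` is the half spectrum of `z` up to a sign and a linear phase. -/
structure IsNormalForm (z : ZMod N → ℂ) (s e : ℂ) (v : ℕ → ℂ) : Prop where
  sign : s = 1 ∨ s = -1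
  norm_phase : ‖e‖ = 1
  eq : ∀ k ≤ N / 2, v k = s * coeff z k * e ^ k
  tail : ∀ k, N / 2 < k → v k = 0

lemma coeff_zero_eq_ofReal {z : ZMod N → ℂ} (hz : IsAnalytic z) :
    coeff z 0 = ((coeff z 0).re : ℂ) :=
  (Complex.conj_eq_iff_re.mp (conj_coeff_zero hz)).symm

lemma coeff_half_eq_ofReal {z : ZMod N → ℂ} (hz : IsAnalytic z) {M : ℕ} (hM : N = 2 * M) :
    coeff z M = ((coeff z M).re : ℂ) :=
  (Complex.conj_eq_iff_re.mp (conj_coeff_half hz hM)).symm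

/-- The sign `s` makes the real number `ẑ_0` nonnegative, and then `e = s conj(ẑ_1) / |ẑ_1|` rotates
`s ẑ_1` onto the positive axis. -/
lemma exists_normalForm {z : ZMod N → ℂ} (hz : IsAnalytic z) (hN : 1 ≤ N / 2)
    (h1 : coeff z 1 ≠ 0) :
    ∃ s e v, IsNormalForm z s e v ∧ v 0 = (‖coeff z 0‖ : ℂ) ∧ v 1 = (‖coeff z 1‖ : ℂ) := by
  obtain ⟨s, hs, hs0⟩ : ∃ s : ℂ, (s = 1 ∨ s = -1) ∧ s * coeff z 0 = (‖coeff z 0‖ : ℂ) := by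
    rw [coeff_zero_eq_ofReal hz, Complex.norm_real, Real.norm_eq_abs]
    rcases le_total 0 (coeff z 0).re with h | h
    · exact ⟨1, Or.inl rfl, by rw [abs_of_nonneg h, one_mul]⟩
    · exact ⟨-1, Or.inr rfl, by rw [abs_of_nonpos h]; push_cast; ring⟩
  have hss : s * s = 1 := by rcases hs with rfl | rfl <;> norm_num
  have hsn : ‖s‖ = 1 := by rcases hs with rfl | rfl <;> simp
  have hn : (‖coeff z 1‖ : ℂ) ≠ 0 := by simpa using h1
  refine ⟨s, s * (starRingEnd ℂ) (coeff z 1) / ‖coeff z 1‖,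
    fun k => if k ≤ N / 2 then
      s * coeff z k * (s * (starRingEnd ℂ) (coeff z 1) / ‖coeff z 1‖) ^ k else 0,
    ⟨hs, ?_, fun k hk => if_pos hk, fun k hk => if_neg (by omega)⟩, ?_, ?_⟩
  · rw [norm_div, norm_mul, hsn, RCLike.norm_conj, Complex.norm_real, norm_norm, one_mul]
    exact div_self (by simpa using h1)
  · simpa using hs0
  · simp only [if_pos hN, pow_one]
    have h2 : coeff z 1 * (starRingEnd ℂ) (coeff z 1) = (‖coeff z 1‖ : ℂ) ^ 2 :=
      Complex.mul_conj' _
    field_simp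
    linear_combination coeff z 1 * (starRingEnd ℂ) (coeff z 1) * hss + h2

lemma IsNormalForm.conj {z : ZMod N → ℂ} {s e : ℂ} {v : ℕ → ℂ} (h : IsNormalForm z s e v) :
    IsNormalForm (reflect z) s ((starRingEnd ℂ) e) (fun j => (starRingEnd ℂ) (v j)) := by
  have hsc : (starRingEnd ℂ) s = s := by rcases h.sign with rfl | rfl <;> simp
  refine ⟨h.sign, by rw [RCLike.norm_conj, h.norm_phase], fun k hk => ?_, fun k hk => ?_⟩
  · rw [h.eq k hk, map_mul, map_mul, map_pow, hsc, coeff, coeff, dft_reflect]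
  · rw [h.tail k hk, map_zero]

lemma IsNormalForm.fits {z : ZMod N → ℂ} {s e : ℂ} {v : ℕ → ℂ} (h : IsNormalForm z s e v)
    {b : ℕ → ℕ → ℝ} {k m : ℕ} (hk : k ≤ N / 2) (hf : Fits N L b (coeff z) k m) :
    Fits N L b v k m := by
  rw [Fits] at hf ⊢
  rw [hf]
  congr 1
  have hss : s * s = 1 := by rcases h.sign with rfl | rfl <;> norm_num
  have hsum : ∑ l ∈ Finset.range (k + 1), v l * v (k - l) * rootW N L ^ (l * m) =
      e ^ k * ∑ l ∈ Finset.range (k + 1),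
        coeff z l * coeff z (k - l) * rootW N L ^ (l * m) := by
    rw [Finset.mul_sum]
    refine Finset.sum_congr rfl fun l hl => ?_
    rw [Finset.mem_range] at hl
    rw [h.eq l (by omega), h.eq (k - l) (by omega), ← pow_sub_mul_pow e (show l ≤ k by omega)]
    linear_combination (coeff z l * coeff z (k - l) * e ^ (k - l) * e ^ l *
      rootW N L ^ (l * m)) * hss
  rw [hsum, norm_mul, norm_pow, h.norm_phase, one_pow, one_mul]

/-- The final step of the algorithm recovers the signal from its normal form. -/
theorem IsNormalForm.finalSignal {z : ZMod N → ℂ} {s e : ℂ} {v : ℕ → ℂ}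
    (h : IsNormalForm z s e v) (hz : IsAnalytic z) (hN : N = 2 * (N / 2))
    (hne : coeff z (N / 2) ≠ 0) : SameUpToAmbiguity (finalSignal N v) z := by
  set M := N / 2 with hM
  set θ : ℝ := Complex.arg (v M) with hθ
  -- The linear phase that remains per frequency after the correction by `arg v_{N/2}`.
  set η : ℂ := e * Complex.exp (-(Complex.I * (2 / (N : ℂ)) * (θ : ℂ))) with hη
  have hN0 : (N : ℂ) ≠ 0 := NeZero.ne _
  have hNM : (N : ℂ) = 2 * M := by
    conv_lhs => rw [hN]
    push_cast; ring
  have hss : s * s = 1 := by rcases h.sign with rfl | rfl <;> norm_num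
  have hsn : ‖s‖ = 1 := by rcases h.sign with rfl | rfl <;> simp
  have hvM := h.eq M le_rfl
  have hq := coeff_half_eq_ofReal hz hN
  set q : ℝ := (coeff z M).re with hqdef
  have hq0 : (q : ℂ) ≠ 0 := by rw [← hq]; exact hne
  have hnv : ‖v M‖ = |q| := by
    rw [hvM, norm_mul, norm_mul, hsn, norm_pow, h.norm_phase, hq, Complex.norm_real,
      Real.norm_eq_abs]
    ring
  have hv : ((|q| : ℝ) : ℂ) * Complex.exp (θ * Complex.I) = s * q * e ^ M := by
    have := Complex.norm_mul_exp_arg_mul_I (v M)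
    rw [hnv, hvM] at this
    rw [← hq, ← this, hθ, hvM]
  have hηM : η ^ M * Complex.exp (θ * Complex.I) = e ^ M := by
    have hM0 : (M : ℂ) ≠ 0 := fun h0 => hN0 (by rw [hNM, h0, mul_zero])
    rw [hη, mul_pow, ← Complex.exp_nat_mul, mul_assoc, ← Complex.exp_add]
    have : (M : ℂ) * -(Complex.I * (2 / (N : ℂ)) * (θ : ℂ)) + θ * Complex.I = 0 := by
      rw [hNM]; field_simp; ring
    rw [this, Complex.exp_zero, mul_one]
  -- Since `ẑ_{N/2} = q` is real, `hv` and `hηM` give `η ^ M = |q| / (s q) = ±1`. The exponent `l`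
  -- with `η = exp(2πi/N) ^ l` is then the translation sought.
  have hηN : η ^ N = 1 := by
    have habs : ((|q| : ℝ) : ℂ) ^ 2 = (q : ℂ) ^ 2 := by exact_mod_cast sq_abs q
    have h1 : (q : ℂ) ^ 2 * (Complex.exp (θ * Complex.I)) ^ 2 * (η ^ M) ^ 2 =
        (q : ℂ) ^ 2 * (Complex.exp (θ * Complex.I)) ^ 2 * 1 := by
      calc (q : ℂ) ^ 2 * (Complex.exp (θ * Complex.I)) ^ 2 * (η ^ M) ^ 2
          = (q : ℂ) ^ 2 * (η ^ M * Complex.exp (θ * Complex.I)) ^ 2 := by ring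
        _ = (q : ℂ) ^ 2 * (e ^ M) ^ 2 := by rw [hηM]
        _ = (s * q * e ^ M) ^ 2 := by linear_combination (-(q : ℂ) ^ 2 * (e ^ M) ^ 2) * hss
        _ = ((|q| : ℝ) : ℂ) ^ 2 * (Complex.exp (θ * Complex.I)) ^ 2 := by rw [← hv]; ring
        _ = _ := by rw [habs, mul_one]
    have h2 := mul_left_cancel₀ (mul_ne_zero (pow_ne_zero 2 hq0)
      (pow_ne_zero 2 (Complex.exp_ne_zero _))) h1
    rw [hN, mul_comm, pow_mul, h2]
  obtain ⟨l, hl, hζ⟩ := (Complex.isPrimitiveRoot_exp N (NeZero.ne N)).eq_pow_of_pow_eq_one hηN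
  refine ⟨s, l, h.sign, Or.inl ?_⟩
  rw [FROG.finalSignal, LinearEquiv.symm_apply_eq]
  funext k
  rw [_root_.map_smul, Pi.smul_apply, smul_eq_mul, dft_translate]
  have hk : dft z k = coeff z k.val := by rw [coeff, ZMod.natCast_zmod_val]
  rw [hk]
  rcases le_or_gt k.val M with hkM | hkM
  · have h1 : Complex.exp (-(Complex.I * (2 * (k.val : ℂ) / (N : ℂ)) * (θ : ℂ))) =
        Complex.exp (-(Complex.I * (2 / (N : ℂ)) * (θ : ℂ))) ^ k.val := by
      rw [← Complex.exp_nat_mul]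
      congr 1
      ring
    have h2 : (stdAddChar (((l : ℤ) : ZMod N) * k) : ℂ) = η ^ k.val := by
      have h3 : (((l : ℤ) : ZMod N) * k) = (((l * k.val : ℕ) : ℤ) : ZMod N) := by
        push_cast
        rw [ZMod.natCast_zmod_val]
      rw [h3, stdAddChar_coe, ← hζ, ← pow_mul, ← Complex.exp_nat_mul]
      congr 1
      push_cast
      ring
    rw [h.eq _ hkM, h1, h2, hη, mul_pow]
    ring
  · rw [h.tail _ hkM, coeff_eq_zero hz (by omega) (ZMod.val_lt k)]
    ring

end NormalForm

/-! ### Finding the modulus of `ẑ_0` -/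

section FirstEntry

variable {N L : ℕ} {I : Shifts} {b : ℕ → ℕ → ℝ}

lemma fits_two_iff (u : ℕ → ℂ) (m : ℕ) : Fits N L b u 2 m ↔
    1 / (N : ℝ) * ‖u 0 * u 2 * (1 + rootW N L ^ (2 * m)) + u 1 ^ 2 * rootW N L ^ m‖ =
      √(b 2 m) := by
  have h : ∑ l ∈ Finset.range (2 + 1), u l * u (2 - l) * rootW N L ^ (l * m) =
      u 0 * u 2 * (1 + rootW N L ^ (2 * m)) + u 1 ^ 2 * rootW N L ^ m := by
    simp only [Finset.sum_range_succ, Finset.sum_range_zero]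
    norm_num
    ring
  rw [Fits, h, eq_comm]

/-- At frequency 2 the ratio is `1 / cos θ`, so it separates points with distinct real parts. -/
lemma cosRatio_two_mul_re {o : ℂ} (ho : ‖o‖ = 1) (hk : o ^ 2 ≠ -1) :
    cosRatio 2 1 o * o.re = 1 := by
  have h1 := cosRatio_recurrence ho hk (l := 0) (by omega)
  have h2 := cosRatio_symm (k := 2) (l := 0) (o := o) (by omega)
  rw [Nat.sub_zero] at h2
  rw [zero_add, h2, cosRatio_zero ho hk, zero_add] at h1
  linarith

lemma mem_positions_zero {m : ℕ} (hm : m ≤ 1) : (0, m) ∈ I.positions N := by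
  have : m = 0 ∨ m = 1 := by omega
  rcases this with rfl | rfl <;> simp [Shifts.positions]

lemma mem_positions_one : (1, 0) ∈ I.positions N := by
  simp [Shifts.positions]

lemma mem_positions_two (q : Fin 5) : (2, I.i2 q) ∈ I.positions N := by
  simp [Shifts.positions]

lemma mem_positions_three : (3, 0) ∈ I.positions N ∧ (3, I.i3) ∈ I.positions N := by
  simp [Shifts.positions]

lemma mem_positions_of_four_le {k : ℕ} (hk : 4 ≤ k) (hkN : k ≤ N / 2) (p : Fin 3) :
    (k, I.ik k p) ∈ I.positions N := by
  simp only [Shifts.positions, Finset.mem_union, Finset.mem_biUnion, Finset.mem_Icc,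
    Finset.mem_image, Finset.mem_univ, true_and]
  exact Or.inr ⟨k, ⟨hk, hkN⟩, p, rfl⟩

variable [NeZero N] {z : ZMod N → ℂ}

/-- Among the five shifts at frequency `2` there are three that give different equations. -/
lemma Shifts.Admissible.exists_three (hI : I.Admissible N L) (hL : 0 < L) :
    ∃ σ : Fin 3 → Fin 5,
      Function.Injective fun p => cosRatio 2 1 (rootW N L ^ I.i2 (σ p)) := by
  have key : ∀ q q', q ≠ q' → I.i2 q + I.i2 q' ≠ numShifts N L →
      cosRatio 2 1 (rootW N L ^ I.i2 q) ≠ cosRatio 2 1 (rootW N L ^ I.i2 q') := by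
    intro q q' hq hsum he
    refine rootW_pow_re_ne hL (hI.i2_lt q) (hI.i2_lt q') (hI.i2_injective.ne hq) hsum ?_
    have h1 := hI.i2_ne q
    have h2 := hI.i2_ne q'
    rw [mul_comm, pow_mul] at h1 h2
    have e1 := cosRatio_two_mul_re (norm_rootW_pow L _) h1
    have e2 := cosRatio_two_mul_re (norm_rootW_pow L _) h2
    rw [he] at e1
    exact mul_left_cancel₀ (left_ne_zero_of_mul_eq_one e1) (e1.trans e2.symm)
  have h0 := hI.i2_first
  have key0 : ∀ q, q ≠ 0 →
      cosRatio 2 1 (rootW N L ^ I.i2 0) ≠ cosRatio 2 1 (rootW N L ^ I.i2 q) := by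
    intro q hq
    have := hI.i2_lt q
    exact key 0 q hq.symm (by omega)
  -- At most one shift complements `I.i2 1` to `r`, so one of the indices `2`, `3` is free of this
  -- coincidence.
  obtain ⟨q, hq0, hq1, hq⟩ : ∃ q : Fin 5, q ≠ 0 ∧ (1 : Fin 5) ≠ q ∧
      I.i2 1 + I.i2 q ≠ numShifts N L := by
    by_cases h : I.i2 1 + I.i2 2 = numShifts N L
    · refine ⟨3, by decide, by decide, fun h' => ?_⟩
      have := hI.i2_injective.ne (show (2 : Fin 5) ≠ 3 by decide)
      omega
    · exact ⟨2, by decide, by decide, h⟩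
  have e1 := key0 1 (by decide)
  have e2 := key0 q hq0
  have e3 := key 1 q hq1 hq
  refine ⟨![0, 1, q], fun p p' hpp => ?_⟩
  fin_cases p <;> fin_cases p' <;> first | rfl | skip
  · exact absurd hpp e1
  · exact absurd hpp e2
  · exact absurd hpp e1.symm
  · exact absurd hpp e3
  · exact absurd hpp e2.symm
  · exact absurd hpp e3.symm

/-- The squared norm of `X + x P` is a quadratic polynomial in `x` with leading coefficient `|P|²`,
and three values determine it. -/
lemma norm_eq_of_quadratic {X Y P Q : ℂ} {x : Fin 3 → ℝ} (hx : Function.Injective x)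
    (h : ∀ p, ‖X + x p * P‖ = ‖Y + x p * Q‖) : ‖P‖ = ‖Q‖ := by
  have h1 := (quadratic_eq_zero hx (A := Complex.normSq P - Complex.normSq Q)
    (B := 2 * (X.re * P.re + X.im * P.im) - 2 * (Y.re * Q.re + Y.im * Q.im))
    (C := Complex.normSq X - Complex.normSq Y) (fun p => by
      have h2 := normSq_eq_of_norm_eq (h p)
      simp only [Complex.normSq_apply, Complex.add_re, Complex.add_im, Complex.re_ofReal_mul,
        Complex.im_ofReal_mul] at h2 ⊢
      linear_combination h2)).1
  rw [sub_eq_zero, Complex.normSq_eq_norm_sq, Complex.normSq_eq_norm_sq] at h1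
  exact (pow_left_inj₀ (norm_nonneg _) (norm_nonneg _) two_ne_zero).mp h1

/-- The equations of the first part have a solution only for the right modulus. -/
lemma eq_norm_coeff_of_exists (hI : I.Admissible N L) (hL : 0 < L) {t₀ t₁ : ℝ} {c : ℂ}
    (ht₁ : 0 ≤ t₁) (hz : ∀ q, Fits N L b (coeff z) 2 (I.i2 q))
    (hc : ∀ q : Fin 5, 1 / (N : ℝ) * ‖(t₀ : ℂ) * c * (1 + rootW N L ^ (2 * I.i2 q))
      + (t₁ : ℂ) ^ 2 * rootW N L ^ (I.i2 q)‖ = √(b 2 (I.i2 q))) : t₁ = ‖coeff z 1‖ := by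
  obtain ⟨σ, hσ⟩ := hI.exists_three hL
  let u : ℕ → ℂ := fun j => if j = 0 then (t₀ : ℂ) else if j = 1 then (t₁ : ℂ) else c
  have hu : ∀ q, Fits N L b u 2 (I.i2 q) := fun q => (fits_two_iff u _).mpr (hc q)
  have h := norm_eq_of_quadratic hσ (P := u 1 * u 1) (Q := coeff z 1 * coeff z 1) (fun p => by
    have := norm_eq_of_fits (by omega) (hI.i2_ne (σ p)) (hu (σ p)) (hz (σ p))
    rwa [crossTerm_two, crossTerm_two] at this)
  have hu1 : u 1 = (t₁ : ℂ) := rfl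
  rw [hu1, norm_mul, norm_mul, Complex.norm_real, Real.norm_of_nonneg ht₁] at h
  exact (mul_self_inj ht₁ (norm_nonneg _)).mp h

lemma sqrt_measurement_one (hz : IsAnalytic z) (hN : N = 2 * (N / 2)) (hN8 : 8 ≤ N)
    (hb : b 1 0 = measurement L z 1 0) :
    N * √(b 1 0) = 2 * ‖coeff z 0‖ * ‖coeff z 1‖ := by
  have hN0 : (N : ℝ) ≠ 0 := NeZero.ne _
  have h := fits_coeff hz hN (k := 1) (by omega) (by omega) hb
  have h2 : ∑ l ∈ Finset.range (1 + 1), coeff z l * coeff z (1 - l) * rootW N L ^ (l * 0) =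
      2 * (coeff z 0 * coeff z 1) := by
    simp only [Finset.sum_range_succ, Finset.sum_range_zero]
    norm_num
    ring
  rw [Fits, h2, norm_mul, norm_mul, Complex.norm_ofNat] at h
  rw [h]
  field_simp

/-- The first part of the algorithm finds the modulus of `ẑ₀`. -/
theorem firstEntry_eq (hI : I.Admissible N L) (hL : Odd L) (hN : N = 2 * (N / 2)) (hN8 : 8 ≤ N)
    (hz : IsAnalytic z) (h0 : coeff z 0 ≠ 0) (h1 : coeff z 1 ≠ 0)
    (hb : ∀ p ∈ I.positions N, b p.1 p.2 = measurement L z p.1 p.2) :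
    firstEntry N L I b = ‖coeff z 0‖ := by
  have hN0 : (0 : ℝ) < N := by exact_mod_cast NeZero.pos N
  have hr := coeff_zero_eq_ofReal hz
  have hq := coeff_half_eq_ofReal hz hN
  set r : ℝ := (coeff z 0).re with hrdef
  set q : ℝ := (coeff z (N / 2)).re with hqdef
  have hnr : ‖coeff z 0‖ = |r| := by rw [hr, Complex.norm_real, Real.norm_eq_abs]
  have hr0 : 0 < |r| := by rw [← hnr]; exact norm_pos_iff.mpr h0
  have hn1 : 0 < ‖coeff z 1‖ := norm_pos_iff.mpr h1
  have b00 : √(b 0 0) = 1 / N * (r ^ 2 + q ^ 2) := by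
    rw [hb _ (mem_positions_zero (m := 0) (by omega)), measurement_zero_eq hz hN hL,
      Real.sqrt_sq (by positivity), hr, hq, pow_zero, mul_one]
    norm_cast
    rw [Real.norm_of_nonneg (by positivity)]
  have b01 : √(b 0 1) = 1 / N * |r ^ 2 - q ^ 2| := by
    rw [hb _ (mem_positions_zero (m := 1) le_rfl), measurement_zero_eq hz hN hL,
      Real.sqrt_sq (by positivity), hr, hq, pow_one, mul_neg, mul_one, ← sub_eq_add_neg]
    norm_cast
  have b10 := sqrt_measurement_one hz hN hN8 (hb _ mem_positions_one)
  have hf2 : ∀ q, Fits N L b (coeff z) 2 (I.i2 q) := fun q =>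
    fits_coeff hz hN (by omega) (by omega) (hb _ (mem_positions_two q))
  rw [hnr, firstEntry]
  by_cases hcase : √(b 0 1) = 0
  · rw [if_pos hcase, b00]
    rw [b01] at hcase
    have h2 : |r ^ 2 - q ^ 2| = 0 :=
      (mul_eq_zero.mp hcase).resolve_left (one_div_ne_zero hN0.ne')
    rw [abs_eq_zero] at h2
    rw [← Real.sqrt_sq_eq_abs]
    congr 1
    field_simp
    linarith
  · rw [if_neg hcase]
    have hne : r ^ 2 ≠ q ^ 2 := fun h => hcase (by rw [b01, h, sub_self, abs_zero, mul_zero])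
    rcases lt_or_gt_of_ne hne with hlt | hgt
    · have ht0 : √(N * (√(b 0 0) + √(b 0 1)) / 2) = |q| := by
        rw [b00, b01, abs_of_neg (by linarith), ← Real.sqrt_sq_eq_abs]
        congr 1
        field_simp
        ring
      have ht0' : √(N * (√(b 0 0) - √(b 0 1)) / 2) = |r| := by
        rw [b00, b01, abs_of_neg (by linarith), ← Real.sqrt_sq_eq_abs]
        congr 1
        field_simp
        ring
      have hrq : |r| < |q| := sq_lt_sq.mp hlt
      -- Here `t₀ = |q|` is the wrong candidate. Solvability would force `t₁ = |ẑ_1|`, while `t₀ t₁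
      -- = |ẑ_0| |ẑ_1|`; this would give `|r| = |q|`.
      refine (if_neg ?_).trans ht0'
      rintro ⟨c, hc⟩
      have ht1 := eq_norm_coeff_of_exists hI hL.pos (by positivity) hf2 hc
      rw [ht0, b10, hnr, div_eq_iff (by linarith)] at ht1
      have h3 : ‖coeff z 1‖ * |r| = ‖coeff z 1‖ * |q| := by linear_combination ht1 / 2
      exact hrq.ne (mul_left_cancel₀ hn1.ne' h3)
    · have ht0 : √(N * (√(b 0 0) + √(b 0 1)) / 2) = |r| := by
        rw [b00, b01, abs_of_pos (by linarith), ← Real.sqrt_sq_eq_abs]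
        congr 1
        field_simp
        ring
      -- The candidate is right, and the second entry of the normal form solves the equations.
      refine (if_pos ?_).trans ht0
      obtain ⟨s, e, v, hv, hv0, hv1⟩ := exists_normalForm hz (by omega) h1
      refine ⟨v 2, fun p => ?_⟩
      have h3 := (fits_two_iff v _).mp (hv.fits (by omega) (hf2 p))
      have h4 : 2 * ‖coeff z 0‖ * ‖coeff z 1‖ / (2 * |r|) = ‖coeff z 1‖ := by
        rw [hnr]; field_simp
      rw [hv0, hv1, hnr] at h3
      rw [ht0, b10, h4]
      exact h3

/-- The normal form of a signal is a complete state of the algorithm. -/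
theorem exists_normalForm_isState (hI : I.Admissible N L) (hL : Odd L) (hN : N = 2 * (N / 2))
    (hN8 : 8 ≤ N) (hz : IsAnalytic z) (h0 : coeff z 0 ≠ 0) (h1 : coeff z 1 ≠ 0)
    (hb : ∀ p ∈ I.positions N, b p.1 p.2 = measurement L z p.1 p.2) :
    ∃ s e v, IsNormalForm z s e v ∧ IsState N L I b (N / 2) v ∧ v 0 ≠ 0 ∧ v 1 ≠ 0 := by
  obtain ⟨s, e, v, hv, hv0, hv1⟩ := exists_normalForm hz (by omega) h1
  have hfirst := firstEntry_eq hI hL hN hN8 hz h0 h1 hb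
  have hfit : ∀ k m, 1 ≤ k → k ≤ N / 2 → (k, m) ∈ I.positions N → Fits N L b v k m :=
    fun k m hk hkN hm => hv.fits hkN (fits_coeff hz hN hk hkN (hb _ hm))
  have hn0 : ‖coeff z 0‖ ≠ 0 := norm_ne_zero_iff.mpr h0
  refine ⟨s, e, v, hv, ⟨?_, ?_, ?_, fun _ => ?_, fun j hj hjN p => ?_, hv.tail⟩, ?_, ?_⟩
  · rw [hv0, hfirst]
  · rw [hv1, sqrt_measurement_one hz hN hN8 (hb _ mem_positions_one), hfirst, abs_norm]
    congr 1
    field_simp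
  · refine ⟨hfit 2 0 (by omega) (by omega) ?_, hfit 2 _ (by omega) (by omega)
      (mem_positions_two 1)⟩
    have := mem_positions_two (N := N) (I := I) 0
    rwa [hI.i2_first] at this
  · exact ⟨hfit 3 0 (by omega) (by omega) mem_positions_three.1,
      hfit 3 _ (by omega) (by omega) mem_positions_three.2,
      fun p => hfit 4 _ (by omega) (by omega) (mem_positions_of_four_le le_rfl (by omega) p)⟩
  · exact hfit j _ (by omega) hjN (mem_positions_of_four_le (by omega) hjN p)
  · rw [hv0]; exact_mod_cast hn0
  · rw [hv1]; exact_mod_cast norm_ne_zero_iff.mpr h1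

end FirstEntry

/-! ### Polynomial functions and generic properties -/

section PolynomialFunctions

variable {σ : Type*}

/-- Real polynomial functions. -/
def IsPolyFn (f : (σ → ℝ) → ℝ) : Prop := ∃ P : MvPolynomial σ ℝ, ∀ x, MvPolynomial.eval x P = f x

lemma IsPolyFn.const (c : ℝ) : IsPolyFn fun _ : σ → ℝ => c :=
  ⟨MvPolynomial.C c, fun _ => MvPolynomial.eval_C c⟩

lemma IsPolyFn.coord (i : σ) : IsPolyFn fun x : σ → ℝ => x i :=
  ⟨MvPolynomial.X i, fun _ => MvPolynomial.eval_X i⟩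

lemma IsPolyFn.add {f g : (σ → ℝ) → ℝ} (hf : IsPolyFn f) (hg : IsPolyFn g) :
    IsPolyFn fun x => f x + g x := by
  obtain ⟨P, hP⟩ := hf
  obtain ⟨Q, hQ⟩ := hg
  exact ⟨P + Q, fun x => by rw [map_add, hP, hQ]⟩

lemma IsPolyFn.mul {f g : (σ → ℝ) → ℝ} (hf : IsPolyFn f) (hg : IsPolyFn g) :
    IsPolyFn fun x => f x * g x := by
  obtain ⟨P, hP⟩ := hf
  obtain ⟨Q, hQ⟩ := hg
  exact ⟨P * Q, fun x => by rw [map_mul, hP, hQ]⟩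

lemma IsPolyFn.neg {f : (σ → ℝ) → ℝ} (hf : IsPolyFn f) : IsPolyFn fun x => -f x := by
  obtain ⟨P, hP⟩ := hf
  exact ⟨-P, fun x => by rw [map_neg, hP]⟩

lemma IsPolyFn.sub {f g : (σ → ℝ) → ℝ} (hf : IsPolyFn f) (hg : IsPolyFn g) :
    IsPolyFn fun x => f x - g x := by
  simpa only [sub_eq_add_neg] using hf.add hg.neg

lemma IsPolyFn.pow {f : (σ → ℝ) → ℝ} (hf : IsPolyFn f) (n : ℕ) : IsPolyFn fun x => f x ^ n := by
  obtain ⟨P, hP⟩ := hf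
  exact ⟨P ^ n, fun x => by rw [map_pow, hP]⟩

/-- Complex-valued polynomial functions of real variables. -/
structure IsComplexPolyFn (f : (σ → ℝ) → ℂ) : Prop where
  re : IsPolyFn fun x => (f x).re
  im : IsPolyFn fun x => (f x).im

lemma IsComplexPolyFn.const (c : ℂ) : IsComplexPolyFn fun _ : σ → ℝ => c :=
  ⟨.const _, .const _⟩

lemma IsPolyFn.ofReal {f : (σ → ℝ) → ℝ} (hf : IsPolyFn f) :
    IsComplexPolyFn fun x => (f x : ℂ) :=
  ⟨by simpa only [Complex.ofReal_re] using hf, by simpa only [Complex.ofReal_im] using .const 0⟩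

lemma IsComplexPolyFn.add {f g : (σ → ℝ) → ℂ} (hf : IsComplexPolyFn f) (hg : IsComplexPolyFn g) :
    IsComplexPolyFn fun x => f x + g x :=
  ⟨by simpa only [Complex.add_re] using hf.re.add hg.re,
    by simpa only [Complex.add_im] using hf.im.add hg.im⟩

lemma IsComplexPolyFn.sub {f g : (σ → ℝ) → ℂ} (hf : IsComplexPolyFn f) (hg : IsComplexPolyFn g) :
    IsComplexPolyFn fun x => f x - g x :=
  ⟨by simpa only [Complex.sub_re] using hf.re.sub hg.re,
    by simpa only [Complex.sub_im] using hf.im.sub hg.im⟩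

lemma IsComplexPolyFn.mul {f g : (σ → ℝ) → ℂ} (hf : IsComplexPolyFn f) (hg : IsComplexPolyFn g) :
    IsComplexPolyFn fun x => f x * g x :=
  ⟨by simpa only [Complex.mul_re] using (hf.re.mul hg.re).sub (hf.im.mul hg.im),
    by simpa only [Complex.mul_im] using (hf.re.mul hg.im).add (hf.im.mul hg.re)⟩

lemma IsComplexPolyFn.conj {f : (σ → ℝ) → ℂ} (hf : IsComplexPolyFn f) :
    IsComplexPolyFn fun x => (starRingEnd ℂ) (f x) :=
  ⟨by simpa only [Complex.conj_re] using hf.re, by simpa only [Complex.conj_im] using hf.im.neg⟩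

lemma IsComplexPolyFn.pow {f : (σ → ℝ) → ℂ} (hf : IsComplexPolyFn f) (n : ℕ) :
    IsComplexPolyFn fun x => f x ^ n := by
  induction n with
  | zero => simpa only [pow_zero] using IsComplexPolyFn.const 1
  | succ n ih => simpa only [pow_succ] using ih.mul hf

lemma IsComplexPolyFn.sum {ι : Type*} {f : ι → (σ → ℝ) → ℂ} (s : Finset ι)
    (hf : ∀ i ∈ s, IsComplexPolyFn (f i)) : IsComplexPolyFn fun x => ∑ i ∈ s, f i x := by
  classical
  induction s using Finset.induction_on with
  | empty => simpa only [Finset.sum_empty] using IsComplexPolyFn.const 0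
  | insert i s hi ih =>
    simp only [Finset.sum_insert hi]
    exact (hf i (Finset.mem_insert_self i s)).add
      (ih fun j hj => hf j (Finset.mem_insert_of_mem hj))

lemma IsComplexPolyFn.normSq {f : (σ → ℝ) → ℂ} (hf : IsComplexPolyFn f) :
    IsPolyFn fun x => Complex.normSq (f x) := by
  simpa only [Complex.normSq_apply] using (hf.re.mul hf.re).add (hf.im.mul hf.im)

/-- Validity outside the zero set of a nonzero real polynomial. -/
def Generic (Q : (σ → ℝ) → Prop) : Prop :=
  ∃ P : MvPolynomial σ ℝ, P ≠ 0 ∧ ∀ x, MvPolynomial.eval x P ≠ 0 → Q x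

lemma Generic.mono {Q Q' : (σ → ℝ) → Prop} (h : Generic Q) (hQ : ∀ x, Q x → Q' x) :
    Generic Q' := by
  obtain ⟨P, hP, h⟩ := h
  exact ⟨P, hP, fun x hx => hQ x (h x hx)⟩

lemma Generic.of_forall {Q : (σ → ℝ) → Prop} (h : ∀ x, Q x) : Generic Q :=
  ⟨1, one_ne_zero, fun x _ => h x⟩

lemma Generic.and {Q Q' : (σ → ℝ) → Prop} (h : Generic Q) (h' : Generic Q') :
    Generic fun x => Q x ∧ Q' x := by
  obtain ⟨P, hP, h⟩ := h
  obtain ⟨P', hP', h'⟩ := h'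
  refine ⟨P * P', mul_ne_zero hP hP', fun x hx => ?_⟩
  rw [map_mul] at hx
  exact ⟨h x (left_ne_zero_of_mul hx), h' x (right_ne_zero_of_mul hx)⟩

lemma Generic.ball {ι : Type*} {Q : ι → (σ → ℝ) → Prop} (s : Finset ι)
    (h : ∀ i ∈ s, Generic (Q i)) : Generic fun x => ∀ i ∈ s, Q i x := by
  classical
  induction s using Finset.induction_on with
  | empty => exact .of_forall fun x i hi => absurd hi (Finset.notMem_empty i)
  | insert i s hi ih =>
    refine ((h i (Finset.mem_insert_self i s)).and
      (ih fun j hj => h j (Finset.mem_insert_of_mem hj))).mono fun x hx j hj => ?_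
    rcases Finset.mem_insert.mp hj with rfl | hj
    · exact hx.1
    · exact hx.2 j hj

lemma IsPolyFn.generic_ne_zero {f : (σ → ℝ) → ℝ} (hf : IsPolyFn f) (h : ∃ x, f x ≠ 0) :
    Generic fun x => f x ≠ 0 := by
  obtain ⟨P, hP⟩ := hf
  obtain ⟨x, hx⟩ := h
  exact ⟨P, fun h0 => hx (by rw [← hP, h0, map_zero]), fun x hx => by rwa [hP] at hx⟩

lemma IsComplexPolyFn.generic_ne_zero {f : (σ → ℝ) → ℂ} (hf : IsComplexPolyFn f)
    (h : ∃ x, f x ≠ 0) : Generic fun x => f x ≠ 0 := by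
  have := hf.normSq.generic_ne_zero (by simpa only [ne_eq, Complex.normSq_eq_zero] using h)
  simpa only [ne_eq, Complex.normSq_eq_zero] using this

end PolynomialFunctions

/-! ### Nondegeneracy is generic -/

section GenericSpectra

variable {N L : ℕ} [NeZero N]

lemma isComplexPolyFn_coeff (k : ℕ) :
    IsComplexPolyFn fun x : ZMod N → ℝ => coeff (analyticSignal x) k := by
  simp only [coeff, analyticSignal, LinearEquiv.apply_symm_apply]
  simp only [dft_apply, smul_eq_mul]
  exact (IsComplexPolyFn.const _).mul
    (.sum _ fun j _ => (IsComplexPolyFn.const _).mul (IsPolyFn.coord j).ofReal)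

/-- The half spectrum of an analytic signal can be prescribed. -/
lemma exists_coeff_eq (hN : N = 2 * (N / 2)) (a : ℕ → ℂ) (h0 : (starRingEnd ℂ) (a 0) = a 0)
    (hM : (starRingEnd ℂ) (a (N / 2)) = a (N / 2)) :
    ∃ x : ZMod N → ℝ, ∀ k ≤ N / 2, coeff (analyticSignal x) k = a k := by
  let A : ZMod N → ℂ := fun k => if k.val ≤ N / 2 then a k.val else 0
  have hA : AnalyticSpectrum N (dft (dft.symm A)) := by
    rw [LinearEquiv.apply_symm_apply]
    refine ⟨?_, fun k hk => ?_, fun k hk => ?_⟩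
    · simpa [A] using h0
    · simp only [A, show k.val = N / 2 by omega, le_refl, if_true, hM]
    · simp only [A, show ¬k.val ≤ N / 2 by omega, if_false]
  refine ⟨fun n => (dft.symm A n).re, fun k hk => ?_⟩
  have hN0 := NeZero.pos N
  rw [dft_analyticSignal_re hA, coeff, LinearEquiv.apply_symm_apply]
  simp only [A, ZMod.val_cast_of_lt (show k < N by omega), hk, if_true]

lemma generic_coeff_ne_zero (hN : N = 2 * (N / 2)) {k : ℕ} (hk : k ≤ N / 2) :
    Generic fun x : ZMod N → ℝ => coeff (analyticSignal x) k ≠ 0 := by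
  obtain ⟨x, hx⟩ := exists_coeff_eq hN (fun _ => 1) (map_one _) (map_one _)
  exact (isComplexPolyFn_coeff k).generic_ne_zero ⟨x, by rw [hx k hk]; exact one_ne_zero⟩

lemma isComplexPolyFn_crossTerm (k : ℕ) (o : ℂ) :
    IsComplexPolyFn fun x : ZMod N → ℝ => crossTerm (coeff (analyticSignal x)) k o :=
  .sum _ fun l _ => ((isComplexPolyFn_coeff l).mul (isComplexPolyFn_coeff (k - l))).mul (.const _)

lemma isPolyFn_spread (k : ℕ) (o : Fin 3 → ℂ) :
    IsPolyFn fun x : ZMod N → ℝ => spread (coeff (analyticSignal x)) k o :=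
  (((isComplexPolyFn_crossTerm k (o 1)).sub (isComplexPolyFn_crossTerm k (o 0))).mul
    ((isComplexPolyFn_crossTerm k (o 2)).sub (isComplexPolyFn_crossTerm k (o 0))).conj).im

lemma isPolyFn_excluder {σ : Type*} (f : Fin 3 → ℝ) {S T Y : (σ → ℝ) → ℂ} {C : (σ → ℝ) → ℝ}
    (hS : IsComplexPolyFn S) (hT : IsComplexPolyFn T) (hY : IsComplexPolyFn Y) (hC : IsPolyFn C) :
    IsPolyFn fun x => excluder f (S x) (T x) (Y x) (C x) := by
  have hTS := hT.re.sub hS.re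
  refine (((hT.im.pow 2).mul ((hY.re.sub (hTS.mul (.const (f 2)))).pow 2)).add
    (((((hY.re.mul (hS.re.sub hT.re)).add (hY.im.mul hS.im)).sub
      ((hC.mul hTS).mul (.const (f 1)))).add
      ((hTS.mul (.const (f 2))).mul hT.re)).pow 2)).sub
    ((hT.im.pow 2).mul ((hY.re.pow 2).add (hY.im.pow 2))) |>.add ?_
  exact ((((IsPolyFn.const 2).mul (hT.im.pow 2)).mul hC).mul hTS).mul (.const (f 0))

lemma isPolyFn_spectrumExcluder (f : Fin 3 → ℝ) :
    IsPolyFn fun x : ZMod N → ℝ => spectrumExcluder f (coeff (analyticSignal x)) := by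
  have h := isComplexPolyFn_coeff (N := N)
  have hn := (h 1).normSq
  exact isPolyFn_excluder f
    (hn.ofReal.mul (((IsComplexPolyFn.const 2).mul ((h 1).mul (h 3))).mul ((h 2).conj.pow 2)))
    ((((IsComplexPolyFn.const 2).mul ((h 1).pow 3)).mul (h 3).conj).mul (h 2).normSq.ofReal)
    (hn.ofReal.mul (((IsComplexPolyFn.const 2).mul ((h 0).mul (h 4))).mul ((h 2).conj.pow 2)))
    (hn.mul ((h 2).normSq.pow 2))

/-- Let `d`, `e` be the differences of the coefficient vectors at two shift points from the one at
the base point. If `a_l a_{k-l} = d_l + i e_l`, the real and imaginary parts of the cross-term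
differences are the Gram entries of `d` and `e`, and the spread is minus the Gram determinant. It is
nonzero because `cosRatio_span` makes `d`, `e` independent. -/
lemma exists_spread_ne_zero {k : ℕ} (hk : 4 ≤ k) {o : Fin 3 → ℂ} (ho : ∀ p, ‖o p‖ = 1)
    (hok : ∀ p, o p ^ k ≠ -1) (hre : Function.Injective fun p => (o p).re) :
    ∃ a : ℕ → ℂ, a 0 = 0 ∧ (∀ j, k ≤ j → a j = 0) ∧ spread a k o ≠ 0 := by
  set d : ℕ → ℝ := fun l => cosRatio k l (o 1) - cosRatio k l (o 0) with hd
  set e : ℕ → ℝ := fun l => cosRatio k l (o 2) - cosRatio k l (o 0) with he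
  have hind : ∀ s t : ℝ, (∀ l ∈ Finset.Ico 1 k, s * d l + t * e l = 0) → s = 0 ∧ t = 0 := by
    intro s t hst
    have := cosRatio_span hk ho hok hre (ν := ![-s - t, s, t])
      (by simp only [Fin.sum_univ_three, Matrix.cons_val]; ring) (fun l hl => by
        have := hst l hl
        simp only [Fin.sum_univ_three, Matrix.cons_val, hd, he] at this ⊢
        linear_combination this)
    exact ⟨congrFun this 1, congrFun this 2⟩
  -- The symmetry of `d` and `e` under `l ↦ k - l` gives `a_l = a_{k-l}`, so one square root serves
  -- both factors.
  let a : ℕ → ℂ := fun l =>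
    if l ∈ Finset.Ico 1 k then ((d l : ℂ) + e l * Complex.I) ^ (1 / 2 : ℂ) else 0
  have ha : ∀ l ∈ Finset.Ico 1 k, a l * a (k - l) = (d l : ℂ) + e l * Complex.I := by
    intro l hl
    have hl2 := Finset.mem_Ico.mp hl
    have hl' : k - l ∈ Finset.Ico 1 k := Finset.mem_Ico.mpr (by omega)
    have h1 : d (k - l) = d l := by simp only [hd, cosRatio_symm hl2.2.le]
    have h2 : e (k - l) = e l := by simp only [he, cosRatio_symm hl2.2.le]
    simp only [a, if_pos hl, if_pos hl', h1, h2]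
    rw [← pow_two, one_div]
    exact Complex.cpow_nat_inv_pow _ two_ne_zero
  have hcross : ∀ p, crossTerm a k (o p) - crossTerm a k (o 0) =
      ((∑ l ∈ Finset.Ico 1 k, d l * (cosRatio k l (o p) - cosRatio k l (o 0)) : ℝ) : ℂ) +
      ((∑ l ∈ Finset.Ico 1 k, e l * (cosRatio k l (o p) - cosRatio k l (o 0)) : ℝ) : ℂ) *
        Complex.I := by
    intro p
    push_cast
    rw [crossTerm, crossTerm, ← Finset.sum_sub_distrib, Finset.sum_mul, ← Finset.sum_add_distrib]
    refine Finset.sum_congr rfl fun l hl => ?_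
    rw [ha l hl]
    ring
  refine ⟨a, by simp [a], fun j hj => if_neg (by simp; omega), ?_⟩
  set D := ∑ l ∈ Finset.Ico 1 k, d l * d l with hD
  set G := ∑ l ∈ Finset.Ico 1 k, e l * d l with hG
  set E := ∑ l ∈ Finset.Ico 1 k, e l * e l with hE
  have hG' : ∑ l ∈ Finset.Ico 1 k, d l * e l = G :=
    Finset.sum_congr rfl fun l _ => mul_comm _ _
  have c1 : crossTerm a k (o 1) - crossTerm a k (o 0) = (D : ℂ) + G * Complex.I := hcross 1
  have c2 : crossTerm a k (o 2) - crossTerm a k (o 0) = (G : ℂ) + E * Complex.I := by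
    rw [← hG']; exact hcross 2
  have hs : spread a k o = G * G - D * E := by
    rw [spread, c1, c2]
    simp
    ring
  rw [hs]
  intro h0
  -- Equality in Cauchy–Schwarz: this sum is `D (D E - G²)`. Independence then yields `D = 0`, hence
  -- `d = 0`, which is impossible.
  have hsum : ∑ l ∈ Finset.Ico 1 k, (-G * d l + D * e l) ^ 2 = 0 := by
    have hexp : ∀ g t : ℝ, ∑ l ∈ Finset.Ico 1 k, (-g * d l + t * e l) ^ 2 =
        g ^ 2 * D - 2 * g * t * G + t ^ 2 * E := by
      intro g t
      rw [hD, hG, hE, Finset.mul_sum, Finset.mul_sum, Finset.mul_sum, ← Finset.sum_sub_distrib,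
        ← Finset.sum_add_distrib]
      exact Finset.sum_congr rfl fun l _ => by ring
    rw [hexp]
    linear_combination (-D) * h0
  have hD0 := (hind (-G) D fun l hl => by
    have := (Finset.sum_eq_zero_iff_of_nonneg fun l _ => sq_nonneg _).mp hsum l hl
    exact pow_eq_zero_iff two_ne_zero |>.mp this).2
  have hd0 := (hind 1 0 fun l hl => by
    have := (Finset.sum_eq_zero_iff_of_nonneg fun l _ => mul_self_nonneg _).mp hD0 l hl
    rw [mul_self_eq_zero.mp this]; ring).1
  exact one_ne_zero hd0

lemma exists_spectrumExcluder_ne_zero (f : Fin 3 → ℝ) :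
    ∃ a : ℕ → ℂ, (∀ j, j ≠ 2 → (starRingEnd ℂ) (a j) = a j) ∧ spectrumExcluder f a ≠ 0 := by
  -- With `v_2 = i` the arguments become `S = -2`, `T = 2`, `Y = -2t`, `C = 1`. As `T.im = 0`, the
  -- excluder is a single square, and `t` is chosen to make it `8²`.
  let t : ℝ := f 1 / 2 - f 2 + 1
  let a : ℕ → ℂ := fun j => if j = 2 then Complex.I else if j = 4 then (t : ℂ) else 1
  have h0 : a 0 = 1 := rfl
  have h1 : a 1 = 1 := rfl
  have h2 : a 2 = Complex.I := rfl
  have h3 : a 3 = 1 := rfl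
  have h4 : a 4 = (t : ℂ) := rfl
  refine ⟨a, fun j hj => ?_, ?_⟩
  · simp only [a, if_neg hj]
    split_ifs
    · exact Complex.conj_ofReal _
    · exact map_one _
  · have hval : spectrumExcluder f a = (8 * t - 4 * f 1 + 8 * f 2) ^ 2 := by
      rw [spectrumExcluder, h0, h1, h2, h3, h4, excluder]
      simp
      ring
    rw [hval, show 8 * t - 4 * f 1 + 8 * f 2 = 8 by simp only [t]; ring]
    norm_num

/-- Generic analytic signals have a recoverable spectrum. -/
theorem generic_nonDegenerate (hN : N = 2 * (N / 2)) (hN8 : 8 ≤ N) (hL : 0 < L) :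
    Generic fun x : ZMod N → ℝ => NonDegenerate N L (N / 2) (coeff (analyticSignal x)) := by
  have h2 := generic_coeff_ne_zero hN (k := 2) (by omega)
  -- Ranging over all pairs of shifts below `r`, rather than over one choice of shifts, makes the
  -- final polynomial depend on `N` and `L` only.
  have hs := Generic.ball (σ := ZMod N)
    (Q := fun (t : ℕ × ℕ × ℕ) x => AdmissiblePair N L t.1 t.2.1 t.2.2 →
      spread (coeff (analyticSignal x)) t.1 (shiftPoints N L t.2.1 t.2.2) ≠ 0)
    (Finset.Icc 4 (N / 2) ×ˢ Finset.range (numShifts N L) ×ˢ Finset.range (numShifts N L))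
    (fun ⟨k, i, j⟩ ht => by
      simp only [Finset.mem_product, Finset.mem_Icc] at ht
      by_cases hij : AdmissiblePair N L k i j
      · obtain ⟨a, ha0, hak, hne⟩ := exists_spread_ne_zero ht.1.1 (norm_shiftPoints (L := L) i j)
          hij.pow_ne (hij.re_injective hL)
        obtain ⟨x, hx⟩ := exists_coeff_eq hN a (by rw [ha0, map_zero])
          (by rw [hak _ ht.1.2, map_zero])
        refine ((isPolyFn_spread k _).generic_ne_zero ⟨x, ?_⟩).mono fun x hx _ => hx
        rwa [spread_of_proportional (s := 1) (e := 1) (Or.inl rfl) norm_one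
          (fun l hl => by rw [hx l (hl.trans ht.1.2), one_mul, one_pow, mul_one])]
      · exact .of_forall fun x h => absurd h hij)
  have he := Generic.ball (σ := ZMod N)
    (Q := fun (t : ℕ × ℕ) x => AdmissiblePair N L 4 t.1 t.2 → ∃ f : Fin 3 → ℝ,
      (∀ p, cosRatio 4 1 (shiftPoints N L t.1 t.2 p) * cosRatio 4 2 (shiftPoints N L t.1 t.2 p) =
        f 0 + f 1 * cosRatio 4 1 (shiftPoints N L t.1 t.2 p) +
          f 2 * cosRatio 4 2 (shiftPoints N L t.1 t.2 p)) ∧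
      spectrumExcluder f (coeff (analyticSignal x)) ≠ 0)
    (Finset.range (numShifts N L) ×ˢ Finset.range (numShifts N L))
    (fun ⟨i, j⟩ _ => by
      by_cases hij : AdmissiblePair N L 4 i j
      -- The coefficients `f` depend on the shifts but not on `x`, so the excluder is polynomial in
      -- `x`.
      · obtain ⟨f, hf⟩ := exists_interpolation (norm_shiftPoints (L := L) i j) hij.pow_ne
          (hij.re_injective hL) (fun p => cosRatio 4 1 (shiftPoints N L i j p) *
            cosRatio 4 2 (shiftPoints N L i j p))
        obtain ⟨a, ha, hne⟩ := exists_spectrumExcluder_ne_zero f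
        obtain ⟨x, hx⟩ := exists_coeff_eq hN a (ha 0 (by omega)) (ha _ (by omega))
        refine ((isPolyFn_spectrumExcluder f).generic_ne_zero ⟨x, ?_⟩).mono
          fun x hx _ => ⟨f, hf, hx⟩
        rwa [spectrumExcluder_of_proportional (s := 1) (e := 1) (Or.inl rfl) norm_one
          (fun l hl => by rw [hx l (by omega), one_mul, one_pow, mul_one])]
      · exact .of_forall fun x h => absurd h hij)
  refine (h2.and (hs.and he)).mono fun x ⟨h2, hs, he⟩ => ⟨h2, fun k hk i j hij => ?_,
    fun i j hij => ?_⟩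
  · exact hs (k, i, j) (Finset.mem_product.mpr ⟨hk, Finset.mem_product.mpr
      ⟨Finset.mem_range.mpr hij.left_lt, Finset.mem_range.mpr hij.right_lt⟩⟩) hij
  · exact he (i, j) (Finset.mem_product.mpr
      ⟨Finset.mem_range.mpr hij.left_lt, Finset.mem_range.mpr hij.right_lt⟩) hij

end GenericSpectra

/-! ### Counting the prescribed measurements -/

section Positions

variable {N L : ℕ} {I : Shifts}

/-- The blocks are separated by their frequencies, and `3 + 5 + 2 + 3 (N/2 - 3) = 3N/2 + 1`. -/
lemma Shifts.Admissible.card_positions (hI : I.Admissible N L) (hN : N = 2 * (N / 2))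
    (hN8 : 8 ≤ N) : (I.positions N).card = 3 * N / 2 + 1 := by
  have hfst : ∀ (k : ℕ) {ι : Type} [Fintype ι] (g : ι → ℕ) (x : ℕ × ℕ),
      x ∈ Finset.univ.image (fun q : ι => (k, g q)) → x.1 = k := by
    intro k ι _ g x hx
    obtain ⟨q, -, rfl⟩ := Finset.mem_image.mp hx
    rfl
  have hinj : ∀ (k : ℕ) {ι : Type} [Fintype ι] (g : ι → ℕ), Function.Injective g →
      (Finset.univ.image (fun q : ι => (k, g q))).card = Fintype.card ι := by
    intro k ι _ g hg
    rw [Finset.card_image_of_injective _ fun p q h => hg (Prod.ext_iff.mp h).2, Finset.card_univ]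
  have c1 : ({(0, 0), (0, 1), (1, 0)} : Finset (ℕ × ℕ)).card = 3 := by decide
  have f1 : ∀ x ∈ ({(0, 0), (0, 1), (1, 0)} : Finset (ℕ × ℕ)), x.1 < 2 := by decide
  have c3 : ({(3, 0), (3, I.i3)} : Finset (ℕ × ℕ)).card = 2 := by
    refine Finset.card_pair fun h => ?_
    have h1 := (Prod.ext_iff.mp h).2
    have h2 := hI.i3_pos
    simp only at h1
    omega
  have f3 : ∀ x ∈ ({(3, 0), (3, I.i3)} : Finset (ℕ × ℕ)), x.1 = 3 := by
    intro x hx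
    simp only [Finset.mem_insert, Finset.mem_singleton] at hx
    rcases hx with rfl | rfl <;> rfl
  have c4 : ((Finset.Icc 4 (N / 2)).biUnion
      (fun k => Finset.univ.image (fun p : Fin 3 => (k, I.ik k p)))).card = 3 * (N / 2 - 3) := by
    rw [Finset.card_biUnion]
    · rw [Finset.sum_congr rfl (g := fun _ => 3) fun k hk => ?_, Finset.sum_const, Nat.card_Icc,
        smul_eq_mul]
      · omega
      · obtain ⟨h4, hk⟩ := Finset.mem_Icc.mp hk
        rw [hinj k _ (hI.ik_injective k h4 hk), Fintype.card_fin]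
    · intro k _ k' _ hkk
      rw [Function.onFun, Finset.disjoint_left]
      exact fun x hx hx' => hkk ((hfst k _ x hx).symm.trans (hfst k' _ x hx'))
  have f4 : ∀ x ∈ (Finset.Icc 4 (N / 2)).biUnion
      (fun k => Finset.univ.image (fun p : Fin 3 => (k, I.ik k p))), 4 ≤ x.1 := by
    intro x hx
    obtain ⟨k, hk, hx⟩ := Finset.mem_biUnion.mp hx
    rw [hfst k _ x hx]
    exact (Finset.mem_Icc.mp hk).1
  rw [Shifts.positions, Finset.card_union_of_disjoint, Finset.card_union_of_disjoint,
    Finset.card_union_of_disjoint, c1, c3, c4, hinj 2 _ hI.i2_injective, Fintype.card_fin]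
  · omega
  · rw [Finset.disjoint_left]
    intro x hx hx'
    have := f1 x hx
    have := hfst 2 _ x hx'
    omega
  · rw [Finset.disjoint_left]
    intro x hx hx'
    have := f3 x hx'
    rcases Finset.mem_union.mp hx with hx | hx
    · have := f1 x hx
      omega
    · have := hfst 2 _ x hx
      omega
  · rw [Finset.disjoint_left]
    intro x hx hx'
    have := f4 x hx'
    rcases Finset.mem_union.mp hx with hx | hx
    · rcases Finset.mem_union.mp hx with hx | hx
      · have := f1 x hx
        omega
      · have := hfst 2 _ x hx
        omega
    · have := f3 x hx
      omega

lemma Shifts.Admissible.positions_lt (hI : I.Admissible N L) (hN8 : 8 ≤ N)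
    (hr : 5 ≤ numShifts N L) {x : ℕ × ℕ} (hx : x ∈ I.positions N) :
    x.1 < N ∧ x.2 < numShifts N L := by
  have h3 := hI.i3_lt
  simp only [Shifts.positions, Finset.mem_union, Finset.mem_insert, Finset.mem_singleton,
    Finset.mem_biUnion, Finset.mem_Icc, Finset.mem_image, Finset.mem_univ, true_and] at hx
  rcases hx with (((rfl | rfl | rfl) | ⟨q, rfl⟩) | (rfl | rfl)) | ⟨k, hk, p, rfl⟩
  · constructor <;> dsimp only <;> omega
  · constructor <;> dsimp only <;> omega
  · constructor <;> dsimp only <;> omega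
  · exact ⟨by dsimp only; omega, hI.i2_lt q⟩
  · constructor <;> dsimp only <;> omega
  · constructor <;> dsimp only <;> omega
  · exact ⟨by dsimp only; omega, hI.ik_lt k hk.1 hk.2 p⟩

end Positions

/-! ### From states back to signals -/

section Recovery

variable {N L : ℕ} [NeZero N] {I : Shifts} {b : ℕ → ℕ → ℝ} {z : ZMod N → ℂ}

/-- Every complete state of the algorithm yields the signal. -/
theorem finalSignal_sameUpToAmbiguity (hI : I.Admissible N L) (hL : Odd L)
    (hN : N = 2 * (N / 2)) (hN8 : 8 ≤ N) (hz : IsAnalytic z) (h0 : coeff z 0 ≠ 0)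
    (h1 : coeff z 1 ≠ 0) (hhalf : coeff z (N / 2) ≠ 0)
    (hnd : NonDegenerate N L (N / 2) (coeff z))
    (hb : ∀ p ∈ I.positions N, b p.1 p.2 = measurement L z p.1 p.2) {u : ℕ → ℂ}
    (hu : IsState N L I b (N / 2) u) : SameUpToAmbiguity (finalSignal N u) z ∧ u (N / 2) ≠ 0 := by
  obtain ⟨s, e, v, hv, hst, hv0, hv1⟩ := exists_normalForm_isState hI hL hN hN8 hz h0 h1 hb
  have hndv := hnd.of_proportional (by omega) hv.sign hv.norm_phase hv.eq
  have hs0 : s ≠ 0 := by rcases hv.sign with rfl | rfl <;> norm_num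
  have he0 : e ≠ 0 := by rw [← norm_ne_zero_iff, hv.norm_phase]; exact one_ne_zero
  have hvM : v (N / 2) ≠ 0 := by
    rw [hv.eq _ le_rfl]
    exact mul_ne_zero (mul_ne_zero hs0 hhalf) (pow_ne_zero _ he0)
  have hext : ∀ v' : ℕ → ℂ, IsState N L I b (N / 2) v' → (∀ j ≤ N / 2, u j = v' j) → u = v' := by
    intro v' hv' h
    funext j
    rcases le_or_gt j (N / 2) with hj | hj
    · exact h j hj
    · rw [hu.tail j hj, hv'.tail j hj]
  rcases hu.eq_or_eq_conj hI hL.pos (by omega) (by omega) le_rfl hst hv0 hv1 hndv with h | h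
  · rw [hext v hst h]
    exact ⟨hv.finalSignal hz hN hhalf, hvM⟩
  -- The conjugate state is a normal form of the reflected signal.
  · rw [hext _ hst.conj h]
    refine ⟨(hv.conj.finalSignal hz.reflect hN ?_).trans (.reflect_self z), by simpa using hvM⟩
    rw [coeff, dft_reflect]
    exact (map_ne_zero _).mpr hhalf

/-- A recoverable signal is determined by its prescribed measurements. -/
theorem sameUpToAmbiguity_of_measurement_eq (hI : I.Admissible N L) (hL : Odd L)
    (hN : N = 2 * (N / 2)) (hN8 : 8 ≤ N) (hz : IsAnalytic z) (h0 : coeff z 0 ≠ 0)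
    (h1 : coeff z 1 ≠ 0) (hhalf : coeff z (N / 2) ≠ 0)
    (hnd : NonDegenerate N L (N / 2) (coeff z)) {z' : ZMod N → ℂ} (hz' : IsAnalytic z')
    (h : ∀ p ∈ I.positions N, measurement L z' p.1 p.2 = measurement L z p.1 p.2) :
    SameUpToAmbiguity z' z := by
  have e1 := sqrt_measurement_one hz hN hN8 (b := measurement L z) rfl
  have e2 := sqrt_measurement_one hz' hN hN8 (b := measurement L z)
    (h _ mem_positions_one).symm
  -- The measurement at `(1, 0)` passes the nonvanishing of `ẑ_0 ẑ_1` on to `z'`.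
  have hprod : 2 * ‖coeff z' 0‖ * ‖coeff z' 1‖ ≠ 0 := by
    rw [← e2, e1]
    exact mul_ne_zero (mul_ne_zero two_ne_zero (norm_ne_zero_iff.mpr h0)) (norm_ne_zero_iff.mpr h1)
  have h0' : coeff z' 0 ≠ 0 :=
    norm_ne_zero_iff.mp (right_ne_zero_of_mul (left_ne_zero_of_mul hprod))
  have h1' : coeff z' 1 ≠ 0 := norm_ne_zero_iff.mp (right_ne_zero_of_mul hprod)
  -- The normal form of `z'` is a complete state for the data of `z`. Its final signal therefore
  -- agrees with both `z` and `z'` up to the ambiguity, and nondegeneracy is needed for `z` only.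
  obtain ⟨s, e, v, hv, hst, -, -⟩ := exists_normalForm_isState hI hL hN hN8 hz' h0' h1'
    (b := measurement L z) fun p hp => (h p hp).symm
  obtain ⟨hsame, hvM⟩ := finalSignal_sameUpToAmbiguity hI hL hN hN8 hz h0 h1 hhalf hnd
    (fun _ _ => rfl) hst
  refine (hv.finalSignal hz' hN fun h0 => hvM ?_).symm.trans hsame
  rw [hv.eq _ le_rfl, h0, mul_zero, zero_mul]

end Recovery

end FROG

theorem theorem3p9 (N L : ℕ) [NeZero N] (hN : Even N) (hN8 : 8 ≤ N) (hL : Odd L)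
    (hr : 5 ≤ FROG.numShifts N L) :
    -- the prescribed measurements are `3N/2 + 1` in number
    (∀ I : FROG.Shifts, I.Admissible N L → (I.positions N).card = 3 * N / 2 + 1) ∧
    FROG.ForGenericAnalytic N (fun z : ZMod N → ℂ =>
      ZMod.dft z 0 ≠ 0 → ZMod.dft z 1 ≠ 0 →
      ∀ I : FROG.Shifts, I.Admissible N L →
        -- the algorithm, run on data of which only the prescribed measurements of `z` are known
        (∀ b : ℕ → ℕ → ℝ,
          (∀ p ∈ I.positions N, b p.1 p.2 = FROG.measurement L z p.1 p.2) →
          -- it can be started, and after any choice of `u_2` it runs to the end in one way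
          (∃ u : ℕ → ℂ, FROG.IsState N L I b 2 u) ∧
          (∀ n : ℕ, 2 ≤ n → n ≠ 3 → n ≤ N / 2 → ∀ u : ℕ → ℂ, FROG.IsState N L I b n u →
            ∃! v : ℕ → ℂ, FROG.IsState N L I b (N / 2) v ∧ ∀ j ≤ n, v j = u j) ∧
          -- every output is `z` up to the ambiguity, and the analytic signals with the same FROG
          -- measurements as `z` are exactly the output up to the ambiguity
          (∀ o : ZMod N → ℂ, FROG.IsOutput N L I b o →
            FROG.SameUpToAmbiguity o z ∧
            ∀ z' : ZMod N → ℂ,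
              (FROG.IsAnalytic z' ∧ ∀ k < N, ∀ m < FROG.numShifts N L,
                FROG.measurement L z' k m = FROG.measurement L z k m) ↔
              FROG.SameUpToAmbiguity z' o)) ∧
        -- `z` is determined up to the ambiguity by its prescribed measurements
        (∀ z' : ZMod N → ℂ, FROG.IsAnalytic z' →
          (∀ p ∈ I.positions N, FROG.measurement L z' p.1 p.2 = FROG.measurement L z p.1 p.2) →
          FROG.SameUpToAmbiguity z' z)) := by
  have hN2 : N = 2 * (N / 2) := by
    obtain ⟨m, hm⟩ := hN
    omega
  refine ⟨fun I hI => hI.card_positions hN2 hN8, ?_⟩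
  have hgen := (FROG.generic_coeff_ne_zero hN2 le_rfl).and
    (FROG.generic_nonDegenerate (L := L) hN2 hN8 hL.pos)
  refine hgen.mono fun x ⟨hhalf, hnd⟩ h0 h1 I hI => ?_
  have hz : FROG.IsAnalytic (FROG.analyticSignal x) := ⟨x, rfl⟩
  generalize FROG.analyticSignal x = z at *
  have hc0 : FROG.coeff z 0 ≠ 0 := by simpa [FROG.coeff] using h0
  have hc1 : FROG.coeff z 1 ≠ 0 := by simpa [FROG.coeff] using h1
  have hdet := fun z' hz' => FROG.sameUpToAmbiguity_of_measurement_eq (z' := z') hI hL hN2 hN8 hz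
    hc0 hc1 hhalf hnd hz'
  refine ⟨fun b hb => ?_, hdet⟩
  obtain ⟨s, e, v, hv, hst, hv0, hv1⟩ :=
    FROG.exists_normalForm_isState hI hL hN2 hN8 hz hc0 hc1 hb
  have hndv := hnd.of_proportional (by omega) hv.sign hv.norm_phase hv.eq
  -- A first choice of `u_2` exists because the true normal form, cut off after index 2, is a state.
  refine ⟨⟨_, hst.truncate le_rfl (by omega)⟩, fun n hn hn3 hnN u hu => ?_, ?_⟩
  · exact hu.existsUnique_extension hI hL.pos (by omega) hn hn3 hnN hst hv0 hv1 hndv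
  · rintro o ⟨u, hu, rfl⟩
    have hsame := (FROG.finalSignal_sameUpToAmbiguity hI hL hN2 hN8 hz hc0 hc1 hhalf hnd hb hu).1
    refine ⟨hsame, fun z' => ⟨fun ⟨hz', hm⟩ => ?_, fun h => ?_⟩⟩
    · refine (hdet z' hz' fun p hp => ?_).trans hsame.symm
      obtain ⟨hk, hp2⟩ := hI.positions_lt hN8 hr hp
      exact hm _ hk _ hp2
    · have h' := h.trans hsame
      exact ⟨h'.isAnalytic hz, fun k _ m _ => h'.measurement_eq L k m⟩
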